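/- Let $\mathrm{PSL}_2(\mathbb Z)=\mathrm{SL}_2(\mathbb Z)/\{\pm 1\}$, and let $a$ and $b$ be the classes of $\begin{pmatrix}0&-1\\1&0\end{pmatrix}$ and $\begin{pmatrix}0&-1\\1&1\end{pmatrix}$; they are generators of orders $2$ and $3$, with $\mathrm{PSL}_2(\mathbb Z)=\langle a,b\mid a^2=b^3=1\rangle$. A word on the alphabet $\{a,b,a^{-1},b^{-1}\}$ is called geodesic if it is a shortest word representing its value in $\mathrm{PSL}_2(\mathbb Z)$. For a subgroup $H$, the Schreier graph of $H$ has as vertices the right cosets $Hg$, with an edge labelled $c$ from $Hg$ to $Hgc$ for every $g\in\mathrm{PSL}_2(\mathbb Z)$ and $c\in\{a,b\}$. The Stallings graph of $H$ is the subgraph of the Schreier graph, rooted at the vertex $H$, that is spanned by the loops at $H$ which are labelled by geodesic words representing elements of $H$ (inverse letters are read by traversing edges backwards). The size of $H$ is the number of vertices of its Stallings graph. **Theorem.** For every $n$, the number $H_n$ of finitely generated subgroups of size $n$ of $\mathrm{PSL}_2(\mathbb Z)$ is finite, and, as $n\to\infty$, $$H_n=\Theta\left(n^{\frac n6+\frac12}\exp\left(-\frac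 n6+n^{\frac23}+n^{\frac12}+\frac13 n^{\frac13}\right)\right).$$ -/

import Mathlib

/-- The modular group: the special linear group over the integers modulo its centre, namely
the identity matrix and its opposite. -/
abbrev PSL2Z : Type := Matrix.ProjectiveSpecialLinearGroup (Fin 2) ℤ

namespace PSL2Z

/-- The two letters of the alphabet. -/
inductive Gen : Type
  | a
  | b

/-- The standard generators of the modular group: the classes of `S` and of `S * T`. They have
orders two and three, and the modular group is the free product of the cyclic groups that they
generate. -/
def Gen.val : Gen → PSL2Z
  | .a => QuotientGroup.mk ModularGroup.S
  | .b => QuotientGroup.mk (ModularGroup.S * ModularGroup.T)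

/-- Words over the letters and their formal inverses: the pair `(c, true)` is the letter `c`, and
the pair `(c, false)` its formal inverse. -/
abbrev Word : Type := List (Gen × Bool)

/-- The group element that a letter or an inverse letter stands for. -/
def letterVal (l : Gen × Bool) : PSL2Z := if l.2 then l.1.val else l.1.val⁻¹

/-- The group element that a word represents. -/
def wordVal (w : Word) : PSL2Z := (w.map letterVal).prod

/-- A word is geodesic if no shorter word represents the same group element. -/
def IsGeodesic (w : Word) : Prop := ∀ w' : Word, wordVal w' = wordVal w → w.length ≤ w'.length

/-- A directed graph with edges labelled by `Gen`, on a set of vertices taken from `V`. -/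
structure LabeledGraph (V : Type) where
  verts : Set V
  Edge : Gen → V → V → Prop
  source_mem : ∀ {c x y}, Edge c x y → x ∈ verts
  target_mem : ∀ {c x y}, Edge c x y → y ∈ verts

/-- The right cosets of the subgroup `H`. -/
abbrev Cosets (H : Subgroup PSL2Z) : Type := Quotient (QuotientGroup.rightRel H)

/-- The right coset of `H` that contains `g`. -/
def coset (H : Subgroup PSL2Z) (g : PSL2Z) : Cosets H := Quotient.mk (QuotientGroup.rightRel H) g

/-- The Schreier graph: every right coset is a vertex, and there is an edge labelled `c` from the
coset of `g` to the coset of `g * c`. -/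
def schreierGraph (H : Subgroup PSL2Z) : LabeledGraph (Cosets H) where
  verts := Set.univ
  Edge c x y := ∃ g : PSL2Z, x = coset H g ∧ y = coset H (g * c.val)
  source_mem _ := Set.mem_univ _
  target_mem _ := Set.mem_univ _

/-- A geodesic word that represents an element of `H`; such a word is the label of a loop at the
vertex `H` of the Schreier graph. -/
def IsGeodesicLoop (H : Subgroup PSL2Z) (w : Word) : Prop := IsGeodesic w ∧ wordVal w ∈ H

/-- The loop at the vertex `H` labelled `w` visits the vertex `x`: some prefix of `w` leads
from `H` to `x`. -/
def Visits (H : Subgroup PSL2Z) (w : Word) (x : Cosets H) : Prop :=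
  ∃ u v : Word, w = u ++ v ∧ x = coset H (wordVal u)

/-- The loop at the vertex `H` labelled `w` traverses the edge labelled `c` from `x` to `y`,
forwards (reading `c` at `x`) or backwards (reading the inverse of `c` at `y`). -/
def Traverses (H : Subgroup PSL2Z) (w : Word) (c : Gen) (x y : Cosets H) : Prop :=
  ∃ u v : Word,
    (w = u ++ (c, true) :: v ∧ x = coset H (wordVal u) ∧
      y = coset H (wordVal (u ++ [(c, true)]))) ∨
    (w = u ++ (c, false) :: v ∧ y = coset H (wordVal u) ∧
      x = coset H (wordVal (u ++ [(c, false)])))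

/-- The Stallings graph of `H`: the subgraph of the Schreier graph spanned by the loops at the
vertex `H` that are labelled by geodesic words representing elements of `H`. -/
def stallingsGraph (H : Subgroup PSL2Z) : LabeledGraph (Cosets H) where
  verts := {x | x ∈ (schreierGraph H).verts ∧ ∃ w, IsGeodesicLoop H w ∧ Visits H w x}
  Edge c x y := (schreierGraph H).Edge c x y ∧ ∃ w, IsGeodesicLoop H w ∧ Traverses H w c x y
  source_mem := by
    rintro c x y ⟨-, w, hw, u, v, ⟨h, hx, hy⟩ | ⟨h, hy, hx⟩⟩
    · exact ⟨Set.mem_univ _, w, hw, u, _, h, hx⟩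
    · exact ⟨Set.mem_univ _, w, hw, u ++ [(c, false)], v, by simp [h], hx⟩
  target_mem := by
    rintro c x y ⟨-, w, hw, u, v, ⟨h, hx, hy⟩ | ⟨h, hy, hx⟩⟩
    · exact ⟨Set.mem_univ _, w, hw, u ++ [(c, true)], v, by simp [h], hy⟩
    · exact ⟨Set.mem_univ _, w, hw, u, _, h, hy⟩

/-- The finitely generated subgroups of size `n`: those whose Stallings graph has exactly `n`
vertices. -/
def subgroupsOfSize (n : ℕ) : Set (Subgroup PSL2Z) :=
  {H | H.FG ∧ (stallingsGraph H).verts.encard = (n : ℕ∞)}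

/-- The number of finitely generated subgroups of size `n`. -/
noncomputable def numSubgroups (n : ℕ) : ℕ := (subgroupsOfSize n).ncard

end PSL2Z

/-! Geodesic words are exactly those in which the letters `a` and `b` alternate. Hence a geodesic
loop through a vertex other than the root enters it by one letter and leaves by the other. Once its
vertices are numbered, the Stallings graph of a subgroup of size n is therefore a partial involution
(for `a`) together with disjoint loops, single edges and oriented triangles (for `b`), and only the
root may miss a letter. Adding a loop at the root where a letter is missing, and recording where,
gives H_n n! ≤ 4 n I_n T_n (`numSubgroups_mul_factorial_le`), where I_n and T_n count the saturated
structures for `a` and for `b` on n labelled points.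

Conversely, each connected rooted saturated pair is a numbered Stallings graph
(`exists_numbered_subgroup`): by finiteness, every reduced path extends to a reduced loop
(`exists_reduced_loop`), so every vertex is visited by a geodesic loop. Disconnected pairs are a
negligible fraction of all pairs (`eventually_sum_pairCount_mul_le`). Thus H_n has the order of n
I_n T_n / n!.

The numbers I_n / n! and T_n / n! are the coefficients of z^n in exp(P(z)), with P = z + z²/2 and P
= z + z² + z³/3 respectively; a single `b`-edge has two orientations, which turns z²/2 into z². Such
a coefficient times r^n exp(-P(r)) is the probability that a weighted sum of independent Poisson
variables equals n. If r is chosen so that the mean is close to n, this probability has the order of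
the inverse standard deviation (`invCoeff_bounds`, `triCoeff_bounds`). Stirling's formula for n!
then gives the stated growth. -/

namespace PSL2Z

/-! ### Poisson weights -/

/-- The probability that a Poisson variable of mean `x` takes the value `k`. -/
noncomputable def poissonWeight (x : ℝ) (k : ℕ) : ℝ := x ^ k / (k.factorial : ℝ) * Real.exp (-x)

lemma poissonWeight_nonneg {x : ℝ} (hx : 0 ≤ x) (k : ℕ) : 0 ≤ poissonWeight x k := by
  unfold poissonWeight; positivity

lemma sum_poissonWeight_le {x : ℝ} (hx : 0 ≤ x) (n : ℕ) :
    ∑ k ∈ Finset.range n, poissonWeight x k ≤ 1 := by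
  unfold poissonWeight
  rw [← Finset.sum_mul, Real.exp_neg, ← div_eq_mul_inv, div_le_one (Real.exp_pos _)]
  exact Real.sum_le_exp_of_nonneg hx n

lemma factorial_le_stirling {n : ℕ} (hn : 1 ≤ n) :
    (n.factorial : ℝ) ≤ Real.exp 1 * √n * (n / Real.exp 1) ^ n := by
  obtain ⟨m, rfl⟩ : ∃ m, n = m + 1 := ⟨n - 1, by omega⟩
  have h := Stirling.stirlingSeq'_antitone (Nat.zero_le m)
  simp only [Function.comp_apply, Nat.succ_eq_add_one, zero_add, Stirling.stirlingSeq_one] at h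
  unfold Stirling.stirlingSeq at h
  rw [div_le_iff₀ (by positivity)] at h
  refine h.trans (le_of_eq ?_)
  rw [Real.sqrt_mul (by norm_num)]
  field_simp

/-- Stirling's lower bound for `k!` together with `x / k ≤ exp (x / k - 1)`, raised to the power
`k`. -/
lemma poissonWeight_le_of_pos {x : ℝ} (hx : 0 ≤ x) {k : ℕ} (hk : 1 ≤ k) :
    poissonWeight x k ≤ 1 / √(2 * Real.pi * k) := by
  have hk0 : (0 : ℝ) < k := by exact_mod_cast hk
  have hs : 0 < √(2 * Real.pi * k) := by positivity
  have h1 := Stirling.le_factorial_stirling k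
  have h2 : (x / k) ^ k ≤ Real.exp (x - k) := by
    have : x / k ≤ Real.exp (x / k - 1) := by linarith [Real.add_one_le_exp (x / k - 1)]
    calc (x / k) ^ k ≤ Real.exp (x / k - 1) ^ k := by gcongr
      _ = Real.exp (x - k) := by
        rw [← Real.exp_nat_mul]; congr 1; field_simp
  have h3 : x ^ k ≤ Real.exp x * (k / Real.exp 1) ^ k := by
    have : x ^ k = (x / k) ^ k * (k : ℝ) ^ k := by rw [← mul_pow]; congr 1; field_simp
    rw [this, div_pow (k : ℝ) (Real.exp 1), ← Real.exp_nat_mul, mul_one]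
    calc (x / k) ^ k * (k : ℝ) ^ k ≤ Real.exp (x - k) * (k : ℝ) ^ k := by gcongr
      _ = _ := by rw [Real.exp_sub]; ring
  unfold poissonWeight
  rw [Real.exp_neg, ← div_eq_mul_inv, div_div, div_le_div_iff₀ (by positivity) hs, one_mul]
  calc x ^ k * √(2 * Real.pi * k) ≤ (Real.exp x * (k / Real.exp 1) ^ k) * √(2 * Real.pi * k) := by
        gcongr
    _ = Real.exp x * (√(2 * Real.pi * k) * (k / Real.exp 1) ^ k) := by ring
    _ ≤ Real.exp x * k.factorial := by gcongr
    _ = _ := by ring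

/-- The ratio of consecutive terms is `x / (j + 1)`, which passes below 1 at the integer part of
`x`: this is the mode of the Poisson law. -/
lemma pow_div_factorial_le_floor {x : ℝ} (hx : 1 ≤ x) (k : ℕ) :
    x ^ k / (k.factorial : ℝ) ≤ x ^ ⌊x⌋₊ / (⌊x⌋₊.factorial : ℝ) := by
  have hstep : ∀ j : ℕ, x ^ (j + 1) / ((j + 1).factorial : ℝ) =
      x ^ j / (j.factorial : ℝ) * (x / (j + 1)) := by
    intro j
    rw [Nat.factorial_succ]; push_cast; field_simp; ring
  rcases le_total k ⌊x⌋₊ with h | h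
  · refine Nat.le_induction (P := fun m _ => m ≤ ⌊x⌋₊ →
      x ^ k / (k.factorial : ℝ) ≤ x ^ m / (m.factorial : ℝ)) (fun _ => le_rfl) ?_ _ h le_rfl
    intro m _ ih hm
    refine (ih (by omega)).trans ?_
    rw [hstep]
    have : ((m : ℝ) + 1) ≤ x := by
      have := Nat.floor_le (show 0 ≤ x by linarith)
      have h2 : ((m + 1 : ℕ) : ℝ) ≤ ⌊x⌋₊ := by exact_mod_cast hm
      push_cast at h2; linarith
    refine le_mul_of_one_le_right (by positivity) ?_
    rwa [le_div_iff₀ (by positivity), one_mul]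
  · induction k, h using Nat.le_induction with
    | base => exact le_rfl
    | succ m hm ih =>
      refine le_trans ?_ ih
      rw [hstep]
      have : x ≤ (m : ℝ) + 1 := by
        have := Nat.lt_floor_add_one x
        have h2 : (⌊x⌋₊ : ℝ) ≤ m := by exact_mod_cast hm
        linarith
      refine mul_le_of_le_one_right (by positivity) ?_
      rwa [div_le_one (by positivity)]

lemma poissonWeight_le {x : ℝ} (hx : 1 ≤ x) (k : ℕ) : poissonWeight x k ≤ 1 / √x := by
  have hf : 1 ≤ ⌊x⌋₊ := Nat.le_floor (by simpa using hx)
  calc poissonWeight x k ≤ poissonWeight x ⌊x⌋₊ := by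
        unfold poissonWeight
        exact mul_le_mul_of_nonneg_right (pow_div_factorial_le_floor hx k) (Real.exp_pos _).le
    _ ≤ 1 / √(2 * Real.pi * ⌊x⌋₊) := poissonWeight_le_of_pos (by linarith) hf
    _ ≤ 1 / √x := by
        have h1 : (1 : ℝ) ≤ ⌊x⌋₊ := by exact_mod_cast hf
        have h2 := Nat.lt_floor_add_one x
        have h3 := Real.pi_gt_three
        refine one_div_le_one_div_of_le (by positivity) (Real.sqrt_le_sqrt ?_)
        nlinarith

/-- Within a bounded number of standard deviations of the mean, the mass is comparable to that at
the mode. Stirling's upper bound is combined with `(x / k) ^ k ≥ exp (x - k - (k - x) ^ 2 / x)`, a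
consequence of `k / x ≤ exp (k / x - 1)`. -/
lemma le_poissonWeight {x A : ℝ} (hx : 1 ≤ x) (hA : 0 ≤ A) {k : ℕ}
    (h : ((k : ℝ) - x) ^ 2 ≤ A * x) :
    Real.exp (-A - 1) / √(2 + A) / √x ≤ poissonWeight x k := by
  have hx0 : 0 < x := by linarith
  rw [div_div, ← Real.sqrt_mul (by linarith)]
  rcases Nat.eq_zero_or_pos k with rfl | hk
  · have hxA : x ≤ A := by
      simp only [Nat.cast_zero, zero_sub, neg_sq] at h
      nlinarith
    have h1 : 1 ≤ √((2 + A) * x) := by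
      rw [Real.one_le_sqrt]; nlinarith
    calc _ ≤ Real.exp (-A - 1) := div_le_self (Real.exp_pos _).le h1
      _ ≤ Real.exp (-x) := Real.exp_le_exp.2 (by linarith)
      _ = _ := by simp [poissonWeight]
  · have hk0 : (0 : ℝ) < k := by exact_mod_cast hk
    -- Otherwise `k - x` would exceed `(1 + A) * x`, whose square is larger than `A * x` because `x
    -- ≥ 1`.
    have hkx : (k : ℝ) ≤ (2 + A) * x := by
      by_contra hcon
      push Not at hcon
      have h1 : (1 + A) * x ≤ k - x := by linarith
      have h2 : ((1 + A) * x) ^ 2 ≤ ((k : ℝ) - x) ^ 2 := by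
        apply pow_le_pow_left₀ (by positivity) h1
      have h3 : A * x < ((1 + A) * x) ^ 2 := by
        have : x ≤ x * x := by nlinarith
        nlinarith [mul_nonneg hA hA, mul_nonneg hA (mul_nonneg hx0.le hx0.le), mul_nonneg (mul_nonneg hA hA) (mul_nonneg hx0.le hx0.le)]
      linarith
    have h2 : Real.exp (x - k - A) ≤ (x / k) ^ k := by
      have h4 : k / x ≤ Real.exp (k / x - 1) := by linarith [Real.add_one_le_exp (k / x - 1)]
      have h5 : Real.exp (1 - k / x) ≤ x / k := by
        have h6 := inv_anti₀ (by positivity) h4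
        rw [← Real.exp_neg, inv_div, neg_sub] at h6
        exact h6
      calc Real.exp (x - k - A) ≤ Real.exp (k * (1 - k / x)) := by
            apply Real.exp_le_exp.2
            have : (k : ℝ) * (1 - k / x) = x - k - (k - x) ^ 2 / x := by field_simp; ring
            rw [this]
            have : ((k : ℝ) - x) ^ 2 / x ≤ A := by rwa [div_le_iff₀ hx0]
            linarith
        _ = Real.exp (1 - k / x) ^ k := by rw [← Real.exp_nat_mul]
        _ ≤ (x / k) ^ k := by gcongr
    have h3 : Real.exp (x - A) * (k / Real.exp 1) ^ k ≤ x ^ k := by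
      have : x ^ k = (x / k) ^ k * (k : ℝ) ^ k := by rw [← mul_pow]; congr 1; field_simp
      rw [this, div_pow (k : ℝ) (Real.exp 1), ← Real.exp_nat_mul, mul_one]
      calc _ = Real.exp (x - k - A) * (k : ℝ) ^ k := by
            rw [show x - k - A = x - A - k by ring, Real.exp_sub (x - A)]; ring
        _ ≤ _ := by gcongr
    have h4 := factorial_le_stirling hk
    have h5 : √(k : ℝ) ≤ √((2 + A) * x) := Real.sqrt_le_sqrt hkx
    unfold poissonWeight
    rw [Real.exp_neg x, ← div_eq_mul_inv, div_div, div_le_div_iff₀ (by positivity) (by positivity)]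
    calc Real.exp (-A - 1) * (k.factorial * Real.exp x)
        ≤ Real.exp (-A - 1) * ((Real.exp 1 * √k * (k / Real.exp 1) ^ k) * Real.exp x) := by gcongr
      _ = (Real.exp (-A - 1) * Real.exp 1 * Real.exp x) * (k / Real.exp 1) ^ k * √k := by ring
      _ = Real.exp (x - A) * (k / Real.exp 1) ^ k * √k := by
          rw [← Real.exp_add, ← Real.exp_add]; congr 3; ring
      _ ≤ x ^ k * √((2 + A) * x) := by gcongr

/-! ### Coefficients of the exponential generating functions -/

/-- The coefficient of `z ^ n` in `exp (z + z ^ 2 / 2)`. -/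
noncomputable def invCoeff (n : ℕ) : ℝ :=
  ∑ j ∈ (Finset.range (n + 1)).filter (fun j => 2 * j ≤ n),
    1 / (((n - 2 * j).factorial : ℝ) * j.factorial * 2 ^ j)

/-- The coefficient of `z ^ n` in `exp (z + z ^ 2 + z ^ 3 / 3)`. -/
noncomputable def triCoeff (n : ℕ) : ℝ :=
  ∑ p ∈ (Finset.range (n + 1) ×ˢ Finset.range (n + 1)).filter
      (fun p : ℕ × ℕ => 2 * p.1 + 3 * p.2 ≤ n),
    1 / (((n - 2 * p.1 - 3 * p.2).factorial : ℝ) * p.1.factorial * (p.2.factorial * 3 ^ p.2))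

lemma invCoeff_pos (n : ℕ) : 0 < invCoeff n := by
  refine Finset.sum_pos (fun _ _ => by positivity) ⟨0, by simp⟩

lemma triCoeff_pos (n : ℕ) : 0 < triCoeff n := by
  refine Finset.sum_pos (fun _ _ => by positivity) ⟨(0, 0), by simp⟩

/-- The right side is the probability that `I + 2 * J = n` for independent Poisson variables `I` of
mean `r` and `J` of mean `r ^ 2 / 2`. -/
lemma invCoeff_eq_sum_poissonWeight (r : ℝ) (n : ℕ) :
    invCoeff n * (r ^ n * Real.exp (-(r + r ^ 2 / 2))) =
      ∑ j ∈ (Finset.range (n + 1)).filter (fun j => 2 * j ≤ n),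
        poissonWeight r (n - 2 * j) * poissonWeight (r ^ 2 / 2) j := by
  rw [invCoeff, Finset.sum_mul]
  refine Finset.sum_congr rfl fun j hj => ?_
  have hj' : 2 * j ≤ n := (Finset.mem_filter.1 hj).2
  unfold poissonWeight
  rw [neg_add, Real.exp_add]
  conv_lhs => rw [show n = (n - 2 * j) + 2 * j by omega, pow_add, pow_mul]
  simp only [Nat.add_sub_cancel, div_pow]
  field_simp

lemma triCoeff_eq_sum_poissonWeight (r : ℝ) (n : ℕ) :
    triCoeff n * (r ^ n * Real.exp (-(r + r ^ 2 + r ^ 3 / 3))) =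
      ∑ p ∈ (Finset.range (n + 1) ×ˢ Finset.range (n + 1)).filter
          (fun p : ℕ × ℕ => 2 * p.1 + 3 * p.2 ≤ n),
        poissonWeight r (n - 2 * p.1 - 3 * p.2) * poissonWeight (r ^ 2) p.1 *
          poissonWeight (r ^ 3 / 3) p.2 := by
  rw [triCoeff, Finset.sum_mul]
  refine Finset.sum_congr rfl fun p hp => ?_
  have hp' : 2 * p.1 + 3 * p.2 ≤ n := (Finset.mem_filter.1 hp).2
  unfold poissonWeight
  rw [neg_add, neg_add, Real.exp_add, Real.exp_add]
  conv_lhs => rw [show r ^ n = r ^ (n - 2 * p.1 - 3 * p.2) * (r ^ 2) ^ p.1 * (r ^ 3) ^ p.2 by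
    rw [← pow_mul, ← pow_mul, ← pow_add, ← pow_add]; congr 1; omega]
  simp only [div_pow]
  field_simp

/-- The mass of the variable with the largest variance is at most its value at the mode; once it is
factored out, the other weights belong to distinct values and sum to at most 1. -/
lemma invCoeff_mul_le {r : ℝ} (hr : 2 ≤ r) (n : ℕ) :
    invCoeff n * (r ^ n * Real.exp (-(r + r ^ 2 / 2))) ≤ 2 / r := by
  have h0 : (1 : ℝ) ≤ r ^ 2 / 2 := by nlinarith
  have hs : 1 / √(r ^ 2 / 2) ≤ 2 / r := by
    rw [one_div, ← inv_div r 2]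
    refine inv_anti₀ (by positivity) (Real.le_sqrt_of_sq_le ?_)
    nlinarith
  rw [invCoeff_eq_sum_poissonWeight]
  calc _ ≤ ∑ j ∈ (Finset.range (n + 1)).filter (fun j => 2 * j ≤ n),
        poissonWeight r (n - 2 * j) * (2 / r) := by
        refine Finset.sum_le_sum fun j _ => mul_le_mul_of_nonneg_left
          ((poissonWeight_le h0 j).trans hs) (poissonWeight_nonneg (by linarith) _)
    _ = (∑ i ∈ ((Finset.range (n + 1)).filter (fun j => 2 * j ≤ n)).image (fun j => n - 2 * j),
        poissonWeight r i) * (2 / r) := by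
        rw [← Finset.sum_mul, Finset.sum_image]
        intro x hx y hy hxy
        simp only [Finset.coe_filter, Finset.mem_range, Set.mem_ofPred_eq] at hx hy
        dsimp only at hxy
        omega
    _ ≤ (∑ i ∈ Finset.range (n + 1), poissonWeight r i) * (2 / r) := by
        refine mul_le_mul_of_nonneg_right (Finset.sum_le_sum_of_subset_of_nonneg ?_ fun _ _ _ =>
          poissonWeight_nonneg (by linarith) _) (by positivity)
        intro i hi
        obtain ⟨j, -, rfl⟩ := Finset.mem_image.1 hi
        simp only [Finset.mem_range]; omega
    _ ≤ 1 * (2 / r) := by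
        refine mul_le_mul_of_nonneg_right (sum_poissonWeight_le (by linarith) _) (by positivity)
    _ = _ := one_mul _

lemma triCoeff_mul_le {r : ℝ} (hr : 2 ≤ r) (n : ℕ) :
    triCoeff n * (r ^ n * Real.exp (-(r + r ^ 2 + r ^ 3 / 3))) ≤ 2 / (r * √r) := by
  have h0 : (1 : ℝ) ≤ r ^ 3 / 3 := by nlinarith [sq_nonneg r]
  have hs : 1 / √(r ^ 3 / 3) ≤ 2 / (r * √r) := by
    rw [one_div, ← inv_div (r * √r) 2]
    refine inv_anti₀ (by positivity) (Real.le_sqrt_of_sq_le ?_)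
    rw [div_pow, mul_pow, Real.sq_sqrt (by linarith)]
    nlinarith [sq_nonneg r, mul_nonneg (show 0 ≤ r by linarith) (sq_nonneg r)]
  set c := 2 / (r * √r)
  have hc : 0 ≤ c := by positivity
  have hr0 : 0 ≤ r := by linarith
  rw [triCoeff_eq_sum_poissonWeight]
  calc _ ≤ ∑ p ∈ (Finset.range (n + 1) ×ˢ Finset.range (n + 1)).filter
          (fun p : ℕ × ℕ => 2 * p.1 + 3 * p.2 ≤ n),
          poissonWeight r (n - 2 * p.1 - 3 * p.2) * poissonWeight (r ^ 2) p.1 * c := by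
        refine Finset.sum_le_sum fun p _ => mul_le_mul_of_nonneg_left
          ((poissonWeight_le h0 _).trans hs) (mul_nonneg (poissonWeight_nonneg hr0 _)
            (poissonWeight_nonneg (by positivity) _))
    _ = (∑ q ∈ ((Finset.range (n + 1) ×ˢ Finset.range (n + 1)).filter
          (fun p : ℕ × ℕ => 2 * p.1 + 3 * p.2 ≤ n)).image
            (fun p => (n - 2 * p.1 - 3 * p.2, p.1)),
          poissonWeight r q.1 * poissonWeight (r ^ 2) q.2) * c := by
        rw [← Finset.sum_mul, Finset.sum_image]
        intro x hx y hy hxy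
        simp only [Finset.coe_filter, Finset.mem_product, Finset.mem_range,
          Set.mem_ofPred_eq] at hx hy
        simp only [Prod.mk.injEq] at hxy
        ext
        · exact hxy.2
        · omega
    _ ≤ (∑ q ∈ Finset.range (n + 1) ×ˢ Finset.range (n + 1),
          poissonWeight r q.1 * poissonWeight (r ^ 2) q.2) * c := by
        refine mul_le_mul_of_nonneg_right (Finset.sum_le_sum_of_subset_of_nonneg ?_ fun _ _ _ =>
          mul_nonneg (poissonWeight_nonneg hr0 _) (poissonWeight_nonneg (by positivity) _)) hc
        intro i hi
        obtain ⟨j, hj, rfl⟩ := Finset.mem_image.1 hi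
        simp only [Finset.mem_filter, Finset.mem_product, Finset.mem_range] at hj ⊢
        omega
    _ = ((∑ i ∈ Finset.range (n + 1), poissonWeight r i) *
          ∑ j ∈ Finset.range (n + 1), poissonWeight (r ^ 2) j) * c := by
        rw [Finset.sum_product, Finset.sum_mul_sum]
    _ ≤ (1 * 1) * c := by
        refine mul_le_mul_of_nonneg_right (mul_le_mul (sum_poissonWeight_le hr0 _)
          (sum_poissonWeight_le (by positivity) _) (Finset.sum_nonneg fun _ _ =>
            poissonWeight_nonneg (by positivity) _) zero_le_one) hc
    _ = _ := by ring

/-- Since `r + r ^ 2` is the mean of `I + 2 * J`, there are at least `√r` splittings of `n` in which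
both parts lie within a bounded number of standard deviations of their means. Each contributes at
least a constant times `1 / (√r * r)`. -/
lemma le_invCoeff_mul : ∃ c : ℝ, 0 < c ∧ ∀ (r : ℝ) (n : ℕ), 4 ≤ r →
    |(n : ℝ) - (r + r ^ 2)| ≤ r →
    c / r ≤ invCoeff n * (r ^ n * Real.exp (-(r + r ^ 2 / 2))) := by
  -- In the window below, the deviations from the means are at most `4 * √r` and `5 * r / 2`, whose
  -- squares are at most `16 * r` and `13 * (r ^ 2 / 2)`.
  refine ⟨(Real.exp (-16 - 1) / √(2 + 16)) * (Real.exp (-13 - 1) / √(2 + 13)), by positivity,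
    fun r n hr hn => ?_⟩
  set c₁ := Real.exp (-16 - 1) / √(2 + 16)
  set c₂ := Real.exp (-13 - 1) / √(2 + 13)
  have hc₁ : 0 < c₁ := by positivity
  have hc₂ : 0 < c₂ := by positivity
  have hr0 : 0 < r := by linarith
  obtain ⟨hn1, hn2⟩ := abs_le.1 hn
  have hsq : √r * √r = r := Real.mul_self_sqrt hr0.le
  have hs1 : 1 ≤ √r := by rw [Real.one_le_sqrt]; linarith
  have hsr : √r ≤ r := by nlinarith
  have hr2 : 4 * r ≤ r ^ 2 := by nlinarith
  have hc1 := Nat.le_ceil r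
  have hc2 := Nat.ceil_lt_add_one hr0.le
  have hle : ⌈r⌉₊ + 1 ≤ n := by
    have : ((⌈r⌉₊ + 1 : ℕ) : ℝ) ≤ n := by push_cast; linarith
    exact_mod_cast this
  -- The central splitting; `e` corrects the parity.
  obtain ⟨e, K, he, hK⟩ : ∃ e K : ℕ, e ≤ 1 ∧ n = ⌈r⌉₊ + e + 2 * K :=
    ⟨(n - ⌈r⌉₊) % 2, (n - ⌈r⌉₊) / 2, by omega, by omega⟩
  have heR : (e : ℝ) ≤ 1 := by exact_mod_cast he
  have he0 : (0 : ℝ) ≤ e := by positivity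
  have hKR : (n : ℝ) = ⌈r⌉₊ + e + 2 * K := by exact_mod_cast hK
  have ht : ∀ t ∈ Finset.range (⌊√r⌋₊ + 1), (t : ℝ) ≤ √r ∧ t ≤ K := by
    intro t ht
    have h1 : (t : ℝ) ≤ √r := by
      have h2 : (t : ℝ) ≤ ⌊√r⌋₊ := by
        have := Finset.mem_range.1 ht
        exact_mod_cast (by omega : t ≤ ⌊√r⌋₊)
      exact h2.trans (Nat.floor_le (Real.sqrt_nonneg _))
    refine ⟨h1, ?_⟩
    have : (t : ℝ) ≤ K := by linarith
    exact_mod_cast this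
  rw [invCoeff_eq_sum_poissonWeight]
  calc c₁ * c₂ / r = √r * (c₁ / √r * (c₂ / r)) := by field_simp
    _ ≤ ((Finset.range (⌊√r⌋₊ + 1)).card : ℝ) * (c₁ / √r * (c₂ / r)) := by
        refine mul_le_mul_of_nonneg_right ?_ (by positivity)
        rw [Finset.card_range]; push_cast
        exact (Nat.lt_floor_add_one _).le
    _ = ∑ t ∈ Finset.range (⌊√r⌋₊ + 1), (c₁ / √r * (c₂ / r)) := by
        rw [Finset.sum_const, nsmul_eq_mul]
    _ ≤ ∑ t ∈ Finset.range (⌊√r⌋₊ + 1),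
          poissonWeight r (n - 2 * (K - t)) * poissonWeight (r ^ 2 / 2) (K - t) := by
        refine Finset.sum_le_sum fun t h => ?_
        obtain ⟨h1, h2⟩ := ht t h
        have ht0 : (0 : ℝ) ≤ t := by positivity
        have hi : ((n - 2 * (K - t) : ℕ) : ℝ) = ⌈r⌉₊ + e + 2 * t := by
          rw [show n - 2 * (K - t) = ⌈r⌉₊ + e + 2 * t by omega]; push_cast; ring
        have hj : ((K - t : ℕ) : ℝ) = K - t := by push_cast [h2]; ring
        refine mul_le_mul (le_poissonWeight (by linarith) (by norm_num) ?_) ?_ (by positivity)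
          (poissonWeight_nonneg hr0.le _)
        · rw [hi]
          have h3 : (⌈r⌉₊ : ℝ) + e + 2 * t - r ≤ 4 * √r := by linarith
          have h4 : 0 ≤ (⌈r⌉₊ : ℝ) + e + 2 * t - r := by linarith
          have h5 := pow_le_pow_left₀ h4 h3 2
          rw [mul_pow, Real.sq_sqrt hr0.le] at h5
          linarith
        · refine le_trans ?_ (le_poissonWeight (A := 13) (by nlinarith) (by norm_num) ?_)
          · refine div_le_div_of_nonneg_left hc₂.le (Real.sqrt_pos.2 (by positivity)) ?_
            rw [Real.sqrt_le_left hr0.le]; nlinarith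
          · rw [hj]
            have h3 : 2 * ((K : ℝ) - t - r ^ 2 / 2) ≤ 5 * r := by linarith
            have h4 : -(5 * r) ≤ 2 * ((K : ℝ) - t - r ^ 2 / 2) := by linarith
            have h5 := sq_le_sq' h4 h3
            rw [mul_pow, mul_pow] at h5
            linarith [sq_nonneg r]
    _ = ∑ j ∈ (Finset.range (⌊√r⌋₊ + 1)).image (fun t => K - t),
          poissonWeight r (n - 2 * j) * poissonWeight (r ^ 2 / 2) j := by
        rw [Finset.sum_image]
        intro x hx y hy hxy
        have := (ht x hx).2
        have := (ht y hy).2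
        dsimp only at hxy
        omega
    _ ≤ _ := by
        refine Finset.sum_le_sum_of_subset_of_nonneg ?_ fun _ _ _ =>
          mul_nonneg (poissonWeight_nonneg hr0.le _) (poissonWeight_nonneg (by positivity) _)
        intro j hj
        obtain ⟨t, -, rfl⟩ := Finset.mem_image.1 hj
        simp only [Finset.mem_filter, Finset.mem_range]
        omega

/-- The same window argument in two parameters: about `√r * r` splittings, each of weight at least a
constant times the product of the three inverse standard deviations. -/
lemma le_triCoeff_mul : ∃ c : ℝ, 0 < c ∧ ∀ (r : ℝ) (n : ℕ), 4 ≤ r →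
    |(n : ℝ) - (r + 2 * r ^ 2 + r ^ 3)| ≤ r →
    c / (r * √r) ≤ triCoeff n * (r ^ n * Real.exp (-(r + r ^ 2 + r ^ 3 / 3))) := by
  -- The deviations in the window are at most `6 * √r`, `4 * r` and `5 * r`; the last one satisfies
  -- `25 * r ^ 2 ≤ 75 * (r ^ 3 / 3)`.
  refine ⟨(Real.exp (-36 - 1) / √(2 + 36)) * (Real.exp (-16 - 1) / √(2 + 16)) *
    (Real.exp (-75 - 1) / √(2 + 75)), by positivity, fun r n hr hn => ?_⟩
  set c₁ := Real.exp (-36 - 1) / √(2 + 36)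
  set c₂ := Real.exp (-16 - 1) / √(2 + 16)
  set c₃ := Real.exp (-75 - 1) / √(2 + 75)
  have hc₁ : 0 < c₁ := by positivity
  have hc₂ : 0 < c₂ := by positivity
  have hc₃ : 0 < c₃ := by positivity
  have hr0 : 0 < r := by linarith
  obtain ⟨hn1, hn2⟩ := abs_le.1 hn
  have hsq : √r * √r = r := Real.mul_self_sqrt hr0.le
  have hs1 : 1 ≤ √r := by rw [Real.one_le_sqrt]; linarith
  have hsr : √r ≤ r := by nlinarith
  have hc1 := Nat.le_ceil r
  have hc2 := Nat.ceil_lt_add_one hr0.le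
  have hd1 := Nat.le_ceil (r ^ 2)
  have hd2 := Nat.ceil_lt_add_one (show 0 ≤ r ^ 2 by positivity)
  have hr2 : 4 * r ≤ r ^ 2 := by nlinarith
  have hr3 : 16 * r ≤ r ^ 3 := by nlinarith
  set I := ⌈r⌉₊ with hI
  set J := ⌈r ^ 2⌉₊ with hJ
  have hle : I + 2 * J + 2 ≤ n := by
    have : ((I + 2 * J + 2 : ℕ) : ℝ) ≤ n := by push_cast; linarith
    exact_mod_cast this
  obtain ⟨e, K, he, hK⟩ : ∃ e K : ℕ, e ≤ 2 ∧ n = I + e + 2 * J + 3 * K :=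
    ⟨(n - I - 2 * J) % 3, (n - I - 2 * J) / 3, by omega, by omega⟩
  have heR : (e : ℝ) ≤ 2 := by exact_mod_cast he
  have he0 : (0 : ℝ) ≤ e := by positivity
  have hKR : (n : ℝ) = I + e + 2 * J + 3 * K := by exact_mod_cast hK
  -- A pair `(t, s)` moves the central splitting to `(I + e + 3 * t, J + 3 * s, K - t - 2 * s)`,
  -- which keeps the weighted sum equal to `n`.
  set D := Finset.range (⌊√r⌋₊ + 1) ×ˢ Finset.range (⌊r⌋₊ + 1) with hD
  have ht : ∀ p ∈ D, (p.1 : ℝ) ≤ √r ∧ (p.2 : ℝ) ≤ r ∧ p.1 + 2 * p.2 ≤ K := by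
    intro p hp
    obtain ⟨hp1, hp2⟩ := Finset.mem_product.1 hp
    have h1 : (p.1 : ℝ) ≤ √r := by
      have h2 : (p.1 : ℝ) ≤ ⌊√r⌋₊ := by
        have := Finset.mem_range.1 hp1
        exact_mod_cast (by omega : p.1 ≤ ⌊√r⌋₊)
      exact h2.trans (Nat.floor_le (Real.sqrt_nonneg _))
    have h2 : (p.2 : ℝ) ≤ r := by
      have h2 : (p.2 : ℝ) ≤ ⌊r⌋₊ := by
        have := Finset.mem_range.1 hp2
        exact_mod_cast (by omega : p.2 ≤ ⌊r⌋₊)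
      exact h2.trans (Nat.floor_le hr0.le)
    refine ⟨h1, h2, ?_⟩
    have : ((p.1 + 2 * p.2 : ℕ) : ℝ) ≤ K := by push_cast; linarith
    exact_mod_cast this
  rw [triCoeff_eq_sum_poissonWeight]
  calc c₁ * c₂ * c₃ / (r * √r) = √r * r * (c₁ / √r * (c₂ / r) * (c₃ / (r * √r))) := by field_simp
    _ ≤ (D.card : ℝ) * (c₁ / √r * (c₂ / r) * (c₃ / (r * √r))) := by
        refine mul_le_mul_of_nonneg_right ?_ (by positivity)
        rw [Finset.card_product, Finset.card_range, Finset.card_range]; push_cast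
        exact mul_le_mul (Nat.lt_floor_add_one _).le (Nat.lt_floor_add_one _).le hr0.le
          (by positivity)
    _ = ∑ p ∈ D, (c₁ / √r * (c₂ / r) * (c₃ / (r * √r))) := by
        rw [Finset.sum_const, nsmul_eq_mul]
    _ ≤ ∑ p ∈ D, poissonWeight r (n - 2 * (J + 3 * p.2) - 3 * (K - p.1 - 2 * p.2)) *
          poissonWeight (r ^ 2) (J + 3 * p.2) *
          poissonWeight (r ^ 3 / 3) (K - p.1 - 2 * p.2) := by
        refine Finset.sum_le_sum fun p h => ?_
        obtain ⟨h1, h2, h3⟩ := ht p h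
        obtain ⟨t, s⟩ := p
        dsimp only at h1 h2 h3 ⊢
        have ht0 : (0 : ℝ) ≤ t := by positivity
        have hs0 : (0 : ℝ) ≤ s := by positivity
        have hi : ((n - 2 * (J + 3 * s) - 3 * (K - t - 2 * s) : ℕ) : ℝ) = I + e + 3 * t := by
          rw [show n - 2 * (J + 3 * s) - 3 * (K - t - 2 * s) = I + e + 3 * t by omega]
          push_cast; ring
        have hk : ((K - t - 2 * s : ℕ) : ℝ) = K - t - 2 * s := by
          rw [Nat.sub_sub, Nat.cast_sub h3]; push_cast; ring
        refine mul_le_mul (mul_le_mul (le_poissonWeight (by linarith) (by norm_num) ?_) ?_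
          (by positivity) (poissonWeight_nonneg hr0.le _)) ?_ (by positivity)
          (mul_nonneg (poissonWeight_nonneg hr0.le _) (poissonWeight_nonneg (by positivity) _))
        · rw [hi]
          have h3 : (I : ℝ) + e + 3 * t - r ≤ 6 * √r := by linarith
          have h4 : 0 ≤ (I : ℝ) + e + 3 * t - r := by linarith
          have h5 := pow_le_pow_left₀ h4 h3 2
          rw [mul_pow, Real.sq_sqrt hr0.le] at h5
          linarith
        · refine le_trans (le_of_eq ?_) (le_poissonWeight (A := 16) (by nlinarith)
            (by norm_num) ?_)
          · rw [Real.sqrt_sq hr0.le]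
          · push_cast
            have h3 : (J : ℝ) + 3 * s - r ^ 2 ≤ 4 * r := by linarith
            have h4 : 0 ≤ (J : ℝ) + 3 * s - r ^ 2 := by linarith
            have h5 := pow_le_pow_left₀ h4 h3 2
            linarith [mul_pow (4 : ℝ) r 2]
        · refine le_trans ?_ (le_poissonWeight (A := 75) (by linarith) (by norm_num) ?_)
          · refine div_le_div_of_nonneg_left hc₃.le (Real.sqrt_pos.2 (by positivity)) ?_
            rw [Real.sqrt_le_left (by positivity), mul_pow, Real.sq_sqrt hr0.le]
            nlinarith [pow_pos hr0 3]
          · rw [hk]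
            have h5 : 3 * ((K : ℝ) - t - 2 * s - r ^ 3 / 3) ≤ 15 * r := by linarith
            have h6 : -(15 * r) ≤ 3 * ((K : ℝ) - t - 2 * s - r ^ 3 / 3) := by linarith
            have h7 : ((K : ℝ) - t - 2 * s - r ^ 3 / 3) ^ 2 ≤ 25 * r ^ 2 := by
              have := sq_le_sq' h6 h5
              rw [mul_pow, mul_pow] at this
              linarith
            have h8 : r ^ 2 ≤ r ^ 3 := by nlinarith [sq_nonneg r]
            linarith
    _ = ∑ q ∈ D.image (fun p => (J + 3 * p.2, K - p.1 - 2 * p.2)),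
          poissonWeight r (n - 2 * q.1 - 3 * q.2) * poissonWeight (r ^ 2) q.1 *
          poissonWeight (r ^ 3 / 3) q.2 := by
        rw [Finset.sum_image]
        intro x hx y hy hxy
        have := (ht x hx).2.2
        have := (ht y hy).2.2
        simp only [Prod.mk.injEq] at hxy
        ext <;> omega
    _ ≤ _ := by
        refine Finset.sum_le_sum_of_subset_of_nonneg ?_ fun _ _ _ =>
          mul_nonneg (mul_nonneg (poissonWeight_nonneg hr0.le _)
            (poissonWeight_nonneg (by positivity) _)) (poissonWeight_nonneg (by positivity) _)
        intro j hj
        obtain ⟨t, h, rfl⟩ := Finset.mem_image.1 hj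
        have := (ht t h).2.2
        simp only [Finset.mem_filter, Finset.mem_product, Finset.mem_range]
        omega

/-! ### Saddle-point evaluation of the coefficients. -/

/-- Second order suffices: both applications have `n * d ^ 3` bounded, so the error in `n * log (1 -
d)` only affects constants. -/
lemma abs_log_one_sub_add_le {d : ℝ} (h0 : 0 ≤ d) (h1 : d ≤ 1 / 2) :
    |Real.log (1 - d) + (d + d ^ 2 / 2)| ≤ 2 * d ^ 3 := by
  have h := Real.abs_log_sub_add_sum_range_le (x := d) (by rw [abs_of_nonneg h0]; linarith) 2
  rw [abs_of_nonneg h0] at h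
  simp only [Finset.sum_range_succ, Finset.range_zero, Finset.sum_empty] at h
  norm_num at h
  rw [add_comm]
  refine h.trans ?_
  rw [div_le_iff₀ (by linarith)]
  nlinarith [pow_nonneg h0 3]

/-- The exponential growth of `invCoeff`. -/
noncomputable def invGrowth (n : ℕ) : ℝ :=
  Real.exp (n / 2 + √n - n / 2 * Real.log n) / √n

/-- The exponential growth of `triCoeff`. -/
noncomputable def triGrowth (n : ℕ) : ℝ :=
  Real.exp (n / 3 + (n : ℝ) ^ ((2 : ℝ) / 3) + 1 / 3 * (n : ℝ) ^ ((1 : ℝ) / 3)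
    - n / 3 * Real.log n) / √n

lemma invCoeff_bounds : ∃ c C : ℝ, 0 < c ∧ 0 < C ∧ ∀ n : ℕ, 36 ≤ n →
    c * invGrowth n ≤ invCoeff n ∧ invCoeff n ≤ C * invGrowth n := by
  obtain ⟨c, hc, hlow⟩ := le_invCoeff_mul
  refine ⟨c * Real.exp (-2), 4 * Real.exp 2, by positivity, by positivity, fun n hn => ?_⟩
  have hnR : (36 : ℝ) ≤ n := by exact_mod_cast hn
  have hn0 : (0 : ℝ) < n := by linarith
  set N := √(n : ℝ) with hN
  have hNsq : N ^ 2 = n := Real.sq_sqrt hn0.le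
  have hN6 : 6 ≤ N := Real.le_sqrt_of_sq_le (by linarith)
  have hN0 : 0 < N := by linarith
  -- The approximate solution of `r + r ^ 2 = n`, with error `1 / 4`. Then `r = N * (1 - d)`, and
  -- the exponent `E` at `r` differs from `X` by a bounded amount.
  set r := N - 1 / 2 with hr
  have hr4 : 4 ≤ r := by linarith
  have hr0 : 0 < r := by linarith
  have hlogN : Real.log n = 2 * Real.log N := by rw [← hNsq, Real.log_pow]; norm_num
  set d := 1 / (2 * N) with hd
  have hd0 : 0 ≤ d := by positivity
  have hdN : N * d = 1 / 2 := by rw [hd]; field_simp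
  have hd1 : d ≤ 1 / 2 := by nlinarith
  have hlogr : Real.log r = Real.log N + Real.log (1 - d) := by
    rw [← Real.log_mul (by positivity) (by linarith)]
    congr 1; rw [hr]; linarith
  obtain ⟨hl1, hl2⟩ := abs_le.1 (abs_log_one_sub_add_le hd0 hd1)
  set X := (n : ℝ) / 2 + N - n / 2 * Real.log n with hX
  set E := r + r ^ 2 / 2 - n * Real.log r with hE
  have hndd : (n : ℝ) * d ^ 2 = 1 / 4 := by rw [← hNsq, ← mul_pow, hdN]; norm_num
  have hnd : (n : ℝ) * d = N / 2 := by rw [← hNsq, sq, mul_assoc, hdN]; ring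
  have hnd3 : (n : ℝ) * d ^ 3 ≤ 1 / 8 := by
    rw [pow_succ, ← mul_assoc, hndd]; linarith
  have hEX : E - X = -(3 / 8) + 1 / 8 - n * (Real.log (1 - d) + (d + d ^ 2 / 2)) := by
    rw [hE, hX, hlogr, hlogN, hr]
    linear_combination (1 / 2 : ℝ) * hNsq + hnd + hndd / 2
  have h1 : n * (Real.log (1 - d) + (d + d ^ 2 / 2)) ≤ 1 / 4 := by
    linarith [mul_le_mul_of_nonneg_left hl2 hn0.le]
  have h2 : -(1 / 4) ≤ n * (Real.log (1 - d) + (d + d ^ 2 / 2)) := by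
    linarith [mul_le_mul_of_nonneg_left hl1 hn0.le]
  have hkey : r ^ n * Real.exp (-(r + r ^ 2 / 2)) = Real.exp (-E) := by
    rw [← Real.exp_log (pow_pos hr0 n), ← Real.exp_add, Real.log_pow, hE]
    congr 1; ring
  have hup := invCoeff_mul_le (r := r) (by linarith) n
  have hlo := hlow r n hr4 (by
    rw [show r + r ^ 2 = n - 1 / 4 by rw [hr, ← hNsq]; ring, abs_le]
    constructor <;> linarith)
  rw [hkey, Real.exp_neg, ← div_eq_mul_inv] at hup hlo
  rw [div_le_iff₀ (Real.exp_pos _)] at hup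
  rw [le_div_iff₀ (Real.exp_pos _)] at hlo
  have hG : invGrowth n = Real.exp X / N := rfl
  rw [hG]
  clear_value E X r d N
  constructor
  · refine le_trans ?_ hlo
    calc c * Real.exp (-2) * (Real.exp X / N) = c / N * Real.exp (-2 + X) := by
          rw [Real.exp_add]; ring
      _ ≤ c / r * Real.exp E := by
          gcongr
          · linarith
          · linarith
  · refine hup.trans ?_
    calc 2 / r * Real.exp E ≤ 2 / (N / 2) * Real.exp (2 + X) := by
          gcongr
          · linarith
          · linarith
      _ = _ := by rw [Real.exp_add]; field_simp; ring

lemma triCoeff_bounds : ∃ c C : ℝ, 0 < c ∧ 0 < C ∧ ∀ n : ℕ, 216 ≤ n →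
    c * triGrowth n ≤ triCoeff n ∧ triCoeff n ≤ C * triGrowth n := by
  obtain ⟨c, hc, hlow⟩ := le_triCoeff_mul
  refine ⟨c * Real.exp (-2), 8 * Real.exp 2, by positivity, by positivity, fun n hn => ?_⟩
  have hnR : (216 : ℝ) ≤ n := by exact_mod_cast hn
  have hn0 : (0 : ℝ) < n := by linarith
  have hn2 : (n : ℝ) ^ ((2 : ℝ) / 3) = ((n : ℝ) ^ ((1 : ℝ) / 3)) ^ 2 := by
    rw [← Real.rpow_natCast, ← Real.rpow_mul hn0.le]; norm_num
  have hn3 : ((n : ℝ) ^ ((1 : ℝ) / 3)) ^ 3 = n := by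
    rw [← Real.rpow_natCast, ← Real.rpow_mul hn0.le]; norm_num
  have hG : triGrowth n = Real.exp (n / 3 + (n : ℝ) ^ ((2 : ℝ) / 3)
    + 1 / 3 * (n : ℝ) ^ ((1 : ℝ) / 3) - n / 3 * Real.log n) / √n := rfl
  rw [hn2] at hG
  have hN0 : 0 < (n : ℝ) ^ ((1 : ℝ) / 3) := by positivity
  clear hn2
  generalize (n : ℝ) ^ ((1 : ℝ) / 3) = N at *
  have hN6 : 6 ≤ N := by
    by_contra h
    push Not at h
    have := pow_lt_pow_left₀ h hN0.le (show 3 ≠ 0 by norm_num)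
    linarith
  -- The approximate solution of `r + 2 * r ^ 2 + r ^ 3 = n`, where `N ^ 3 = n`; the error `N / 3 +
  -- 2 / 27` is within the tolerance `r` of the window lemma.
  set r := N - 2 / 3 with hr
  have hr4 : 4 ≤ r := by linarith
  have hr0 : 0 < r := by linarith
  have hlogN : Real.log n = 3 * Real.log N := by rw [← hn3, Real.log_pow]; norm_num
  set d := 2 / (3 * N) with hd
  have hd0 : 0 ≤ d := by positivity
  have hdN : N * d = 2 / 3 := by rw [hd]; field_simp
  have hd1 : d ≤ 1 / 2 := by nlinarith
  have hlogr : Real.log r = Real.log N + Real.log (1 - d) := by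
    rw [← Real.log_mul (by positivity) (by linarith)]
    congr 1; rw [hr]; linarith
  obtain ⟨hl1, hl2⟩ := abs_le.1 (abs_log_one_sub_add_le hd0 hd1)
  set X := (n : ℝ) / 3 + N ^ 2 + 1 / 3 * N - n / 3 * Real.log n with hX
  set E := r + r ^ 2 + r ^ 3 / 3 - n * Real.log r with hE
  have hnd3 : (n : ℝ) * d ^ 3 = 8 / 27 := by rw [← hn3, ← mul_pow, hdN]; norm_num
  have hndd : (n : ℝ) * d ^ 2 = 4 / 9 * N := by
    rw [← hn3, show N ^ 3 * d ^ 2 = N * (N * d) ^ 2 by ring, hdN]; ring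
  have hnd : (n : ℝ) * d = 2 / 3 * N ^ 2 := by
    rw [← hn3, show N ^ 3 * d = N ^ 2 * (N * d) by ring, hdN]; ring
  have hEX : E - X = -(2 / 3) + 4 / 9 - 8 / 81
      - n * (Real.log (1 - d) + (d + d ^ 2 / 2)) := by
    rw [hE, hX, hlogr, hlogN, hr]
    linear_combination (1 / 3 : ℝ) * hn3 + hnd + hndd / 2
  have h1 : n * (Real.log (1 - d) + (d + d ^ 2 / 2)) ≤ 16 / 27 := by
    linarith [mul_le_mul_of_nonneg_left hl2 hn0.le]
  have h2 : -(16 / 27) ≤ n * (Real.log (1 - d) + (d + d ^ 2 / 2)) := by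
    linarith [mul_le_mul_of_nonneg_left hl1 hn0.le]
  have hkey : r ^ n * Real.exp (-(r + r ^ 2 + r ^ 3 / 3)) = Real.exp (-E) := by
    rw [← Real.exp_log (pow_pos hr0 n), ← Real.exp_add, Real.log_pow, hE]
    congr 1; ring
  have hup := triCoeff_mul_le (r := r) (by linarith) n
  have hlo := hlow r n hr4 (by
    rw [show r + 2 * r ^ 2 + r ^ 3 = n - N / 3 - 2 / 27 by rw [hr, ← hn3]; ring, abs_le]
    constructor <;> linarith)
  rw [hkey, Real.exp_neg, ← div_eq_mul_inv] at hup hlo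
  rw [div_le_iff₀ (Real.exp_pos _)] at hup
  rw [le_div_iff₀ (Real.exp_pos _)] at hlo
  have hs : √(n : ℝ) = N * √N := by
    rw [← hn3, pow_succ, Real.sqrt_mul (by positivity), Real.sqrt_sq hN0.le]
  have hsN : √N ≤ 2 * √r := by
    rw [← Real.sqrt_sq (show (0 : ℝ) ≤ 2 by norm_num), ← Real.sqrt_mul (by norm_num)]
    exact Real.sqrt_le_sqrt (by linarith)
  rw [hG, hs]
  clear_value E X r d
  constructor
  · refine le_trans ?_ hlo
    calc c * Real.exp (-2) * (Real.exp X / (N * √N)) = c / (N * √N) * Real.exp (-2 + X) := by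
          rw [Real.exp_add]; ring
      _ ≤ c / (r * √r) * Real.exp E := by
          have hrN : r ≤ N := by linarith
          gcongr
          linarith
  · refine hup.trans ?_
    calc 2 / (r * √r) * Real.exp E ≤ 2 / ((N / 2) * (√N / 2)) * Real.exp (2 + X) := by
          have hrN : N / 2 ≤ r := by linarith
          have hrN' : √N / 2 ≤ √r := by linarith
          gcongr
          linarith
      _ = _ := by rw [Real.exp_add]; field_simp; ring

/-! ### Growth of the number of pairs. -/

/-- The number of pairs of saturated structures on `n` labelled points, divided by `n!`. -/
noncomputable def pairCount (n : ℕ) : ℝ := n.factorial * invCoeff n * triCoeff n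

/-- The exponential growth of `pairCount`. -/
noncomputable def pairGrowth (n : ℕ) : ℝ :=
  Real.exp (n / 6 * Real.log n - n / 6 + (n : ℝ) ^ ((2 : ℝ) / 3) + √n
    + 1 / 3 * (n : ℝ) ^ ((1 : ℝ) / 3)) / √n

lemma pairCount_pos (n : ℕ) : 0 < pairCount n := by
  have := invCoeff_pos n
  have := triCoeff_pos n
  unfold pairCount
  positivity

lemma factorial_bounds {n : ℕ} (hn : 1 ≤ n) :
    √n * Real.exp (n * Real.log n - n) ≤ n.factorial ∧
    (n.factorial : ℝ) ≤ Real.exp 1 * (√n * Real.exp (n * Real.log n - n)) := by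
  have hn0 : (0 : ℝ) < n := by exact_mod_cast hn
  have h : ((n : ℝ) / Real.exp 1) ^ n = Real.exp (n * Real.log n - n) := by
    rw [Real.exp_sub, mul_comm, Real.exp_mul, Real.exp_log hn0, Real.rpow_natCast, div_pow,
      ← Real.exp_nat_mul, mul_one]
  constructor
  · refine le_trans ?_ (Stirling.le_factorial_stirling n)
    rw [h]
    refine mul_le_mul_of_nonneg_right (Real.sqrt_le_sqrt ?_) (Real.exp_pos _).le
    nlinarith [Real.pi_gt_three]
  · rw [← mul_assoc, ← h]
    exact factorial_le_stirling hn

lemma growth_mul {n : ℕ} (hn : 1 ≤ n) :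
    √n * Real.exp (n * Real.log n - n) * invGrowth n * triGrowth n = pairGrowth n := by
  have hn0 : (0 : ℝ) < n := by exact_mod_cast hn
  have hs : 0 < √(n : ℝ) := Real.sqrt_pos.2 hn0
  unfold invGrowth triGrowth pairGrowth
  generalize √(n : ℝ) = s at *
  rw [show ∀ a b c : ℝ, s * a * (b / s) * (c / s) = a * b * c / s from
    fun a b c => by field_simp, ← Real.exp_add, ← Real.exp_add]
  congr 2
  ring

lemma pairCount_bounds : ∃ c C : ℝ, 0 < c ∧ 0 < C ∧ ∀ n : ℕ, 216 ≤ n →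
    c * pairGrowth n ≤ pairCount n ∧ pairCount n ≤ C * pairGrowth n := by
  obtain ⟨c₁, C₁, hc₁, hC₁, h₁⟩ := invCoeff_bounds
  obtain ⟨c₂, C₂, hc₂, hC₂, h₂⟩ := triCoeff_bounds
  refine ⟨c₁ * c₂, Real.exp 1 * C₁ * C₂, by positivity, by positivity, fun n hn => ?_⟩
  obtain ⟨a1, a2⟩ := h₁ n (by omega)
  obtain ⟨b1, b2⟩ := h₂ n hn
  obtain ⟨f1, f2⟩ := factorial_bounds (show 1 ≤ n by omega)
  rw [← growth_mul (by omega)]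
  have g1 : 0 ≤ invGrowth n := by unfold invGrowth; positivity
  have g2 : 0 ≤ triGrowth n := by unfold triGrowth; positivity
  have i1 := invCoeff_pos n
  have i2 := triCoeff_pos n
  unfold pairCount
  constructor
  · calc _ = (√n * Real.exp (n * Real.log n - n)) * (c₁ * invGrowth n) * (c₂ * triGrowth n) := by
          ring
      _ ≤ _ := by gcongr
  · calc _ ≤ (Real.exp 1 * (√n * Real.exp (n * Real.log n - n))) * (C₁ * invGrowth n) *
          (C₂ * triGrowth n) := by gcongr
      _ = _ := by ring

lemma pairGrowth_pos {n : ℕ} (hn : 1 ≤ n) : 0 < pairGrowth n := by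
  have hn0 : (0 : ℝ) < n := by exact_mod_cast hn
  unfold pairGrowth; positivity

lemma pairCount_isTheta : pairCount =Θ[Filter.atTop] pairGrowth := by
  obtain ⟨c, C, hc, hC, h⟩ := pairCount_bounds
  constructor
  · refine Asymptotics.IsBigO.of_bound C (Filter.eventually_atTop.2 ⟨216, fun n hn => ?_⟩)
    rw [Real.norm_of_nonneg (pairCount_pos n).le,
      Real.norm_of_nonneg (pairGrowth_pos (by omega)).le]
    exact (h n hn).2
  · refine Asymptotics.IsBigO.of_bound c⁻¹ (Filter.eventually_atTop.2 ⟨216, fun n hn => ?_⟩)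
    rw [Real.norm_of_nonneg (pairCount_pos n).le,
      Real.norm_of_nonneg (pairGrowth_pos (by omega)).le, le_inv_mul_iff₀ hc]
    exact (h n hn).1

/-- Both sequences are positive for `n ≥ 1`, so the asymptotic bounds extend to the finitely many
remaining indices. This is needed because a splitting may have a small part. -/
lemma pairCount_uniform_bounds : ∃ C : ℝ, 0 < C ∧ ∀ n : ℕ, 1 ≤ n →
    pairCount n ≤ C * pairGrowth n ∧ pairGrowth n ≤ C * pairCount n := by
  obtain ⟨C₁, hC₁, h₁⟩ := Asymptotics.bound_of_isBigO_nat_atTop pairCount_isTheta.1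
  obtain ⟨C₂, hC₂, h₂⟩ := Asymptotics.bound_of_isBigO_nat_atTop pairCount_isTheta.2
  refine ⟨max C₁ C₂, lt_max_of_lt_left hC₁, fun n hn => ?_⟩
  have p1 := pairCount_pos n
  have p2 := pairGrowth_pos hn
  have a1 := h₁ p2.ne'
  have a2 := h₂ p1.ne'
  rw [Real.norm_of_nonneg p1.le, Real.norm_of_nonneg p2.le] at a1 a2
  exact ⟨a1.trans (mul_le_mul_of_nonneg_right (le_max_left _ _) p2.le),
    a2.trans (mul_le_mul_of_nonneg_right (le_max_right _ _) p1.le)⟩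

/-! ### Disconnected pairs are negligible. -/

/-- The factor `n ^ (n / 6)` makes splitting costly: it loses `(k / n) ^ (k / 6)`. The lower-order
terms of `n - k` are at most those of `n`, and those of `k` add up to at most `3 * k ^ (2 / 3)`. -/
lemma pairGrowth_mul_le {k n : ℕ} (hk : 1 ≤ k) (hkn : 2 * k ≤ n) :
    pairGrowth k * pairGrowth (n - k) ≤ 2 * Real.exp (k / 6 * (Real.log k - Real.log n)
      + 3 * (k : ℝ) ^ ((2 : ℝ) / 3)) * pairGrowth n := by
  obtain ⟨m, rfl⟩ : ∃ m, n = k + m := ⟨n - k, by omega⟩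
  rw [Nat.add_sub_cancel_left]
  have hk1 : (1 : ℝ) ≤ k := by exact_mod_cast hk
  have hkm : (k : ℝ) ≤ m := by exact_mod_cast (by omega : k ≤ m)
  have hm0 : (0 : ℝ) < m := by linarith
  have hk0 : (0 : ℝ) < k := by linarith
  unfold pairGrowth
  push_cast
  have e1 : (m : ℝ) ^ ((2 : ℝ) / 3) ≤ ((k : ℝ) + m) ^ ((2 : ℝ) / 3) :=
    Real.rpow_le_rpow hm0.le (by linarith) (by norm_num)
  have e2 : (m : ℝ) ^ ((1 : ℝ) / 3) ≤ ((k : ℝ) + m) ^ ((1 : ℝ) / 3) :=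
    Real.rpow_le_rpow hm0.le (by linarith) (by norm_num)
  have e3 : √(m : ℝ) ≤ √((k : ℝ) + m) := Real.sqrt_le_sqrt (by linarith)
  have e4 : (k : ℝ) ^ ((1 : ℝ) / 3) ≤ (k : ℝ) ^ ((2 : ℝ) / 3) :=
    Real.rpow_le_rpow_of_exponent_le hk1 (by norm_num)
  have e5 : √(k : ℝ) ≤ (k : ℝ) ^ ((2 : ℝ) / 3) := by
    rw [Real.sqrt_eq_rpow]
    exact Real.rpow_le_rpow_of_exponent_le hk1 (by norm_num)
  have e6 : Real.log m ≤ Real.log (k + m) := Real.log_le_log hm0 (by linarith)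
  have e7 : (m : ℝ) / 6 * Real.log m ≤ m / 6 * Real.log (k + m) := by gcongr
  -- Compares the denominators, using `k + m ≤ 4 * k * m`; this is the source of the factor 2.
  have e8 : √((k : ℝ) + m) ≤ 2 * (√(k : ℝ) * √m) := by
    rw [← Real.sqrt_mul hk0.le, ← Real.sqrt_sq (show (0 : ℝ) ≤ 2 by norm_num),
      ← Real.sqrt_mul (by norm_num)]
    refine Real.sqrt_le_sqrt ?_
    nlinarith
  have e9 : 0 ≤ (k : ℝ) ^ ((1 : ℝ) / 3) := by positivity
  have hs : 0 < √((k : ℝ) + m) := by positivity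
  rw [div_mul_div_comm, ← Real.exp_add, ← mul_div_assoc, mul_assoc 2, ← Real.exp_add,
    div_le_div_iff₀ (by positivity) hs]
  have hexp : Real.exp (k / 6 * Real.log k - k / 6 + (k : ℝ) ^ ((2 : ℝ) / 3) + √k
      + 1 / 3 * (k : ℝ) ^ ((1 : ℝ) / 3) + (m / 6 * Real.log m - m / 6 + (m : ℝ) ^ ((2 : ℝ) / 3)
      + √m + 1 / 3 * (m : ℝ) ^ ((1 : ℝ) / 3))) ≤
      Real.exp (k / 6 * (Real.log k - Real.log (k + m)) + 3 * (k : ℝ) ^ ((2 : ℝ) / 3) +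
      ((k + m) / 6 * Real.log (k + m) - (k + m) / 6 + ((k : ℝ) + m) ^ ((2 : ℝ) / 3)
      + √((k : ℝ) + m) + 1 / 3 * ((k : ℝ) + m) ^ ((1 : ℝ) / 3))) := by
    apply Real.exp_le_exp.2
    linarith
  calc _ ≤ _ * (2 * (√(k : ℝ) * √m)) := mul_le_mul hexp e8 hs.le (Real.exp_pos _).le
    _ = _ := by ring

lemma three_mul_rpow_le (k : ℕ) {e : ℝ} (he : 0 < e) :
    3 * (k : ℝ) ^ ((2 : ℝ) / 3) ≤ e * k + 27 / e ^ 2 := by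
  have hk0 : (0 : ℝ) ≤ k := by positivity
  have hn2 : (k : ℝ) ^ ((2 : ℝ) / 3) = ((k : ℝ) ^ ((1 : ℝ) / 3)) ^ 2 := by
    rw [← Real.rpow_natCast, ← Real.rpow_mul hk0]; norm_num
  have hn3 : ((k : ℝ) ^ ((1 : ℝ) / 3)) ^ 3 = k := by
    rw [← Real.rpow_natCast, ← Real.rpow_mul hk0]; norm_num
  have hx0 : 0 ≤ (k : ℝ) ^ ((1 : ℝ) / 3) := by positivity
  rw [hn2]
  generalize (k : ℝ) ^ ((1 : ℝ) / 3) = x at *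
  rw [← hn3]
  rcases le_total (3 / e) x with h | h
  · rw [div_le_iff₀ he] at h
    have : 3 * x ^ 2 ≤ e * x ^ 3 := by nlinarith [sq_nonneg x]
    have : 0 ≤ 27 / e ^ 2 := by positivity
    linarith
  · have h2 := pow_le_pow_left₀ hx0 h 2
    rw [div_pow] at h2
    have : 0 ≤ e * x ^ 3 := by positivity
    have : 27 / e ^ 2 = 3 * (3 ^ 2 / e ^ 2) := by ring
    linarith

/-- The relative weight of the splittings of `n` points into parts of sizes `k ≤ n / 2` and
`n - k`. -/
noncomputable def splitWeight (n k : ℕ) : ℝ :=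
  if 1 ≤ k ∧ 2 * k ≤ n then pairCount k * pairCount (n - k) / pairCount n else 0

lemma splitWeight_nonneg (n k : ℕ) : 0 ≤ splitWeight n k := by
  have := pairCount_pos
  unfold splitWeight
  split_ifs
  · exact div_nonneg (mul_nonneg (this _).le (this _).le) (this _).le
  · exact le_rfl

lemma splitWeight_le : ∃ C : ℝ, 0 < C ∧ ∀ n k : ℕ, 1 ≤ k → 2 * k ≤ n →
    splitWeight n k ≤ C * Real.exp (k / 6 * (Real.log k - Real.log n)
      + 3 * (k : ℝ) ^ ((2 : ℝ) / 3)) := by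
  obtain ⟨C, hC, h⟩ := pairCount_uniform_bounds
  refine ⟨C * C * C * 2, by positivity, fun n k hk hkn => ?_⟩
  have p := pairCount_pos
  have hn0 := pairGrowth_pos (show 1 ≤ n by omega)
  rw [splitWeight, if_pos ⟨hk, hkn⟩, div_le_iff₀ (p n)]
  calc pairCount k * pairCount (n - k)
      ≤ (C * pairGrowth k) * (C * pairGrowth (n - k)) :=
        mul_le_mul (h k hk).1 (h (n - k) (by omega)).1 (p _).le
          ((p k).le.trans (h k hk).1)
    _ = C * C * (pairGrowth k * pairGrowth (n - k)) := by ring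
    _ ≤ C * C * (2 * Real.exp (k / 6 * (Real.log k - Real.log n)
      + 3 * (k : ℝ) ^ ((2 : ℝ) / 3)) * pairGrowth n) := by
        have := pairGrowth_mul_le hk hkn
        gcongr
    _ ≤ C * C * (2 * Real.exp (k / 6 * (Real.log k - Real.log n)
      + 3 * (k : ℝ) ^ ((2 : ℝ) / 3)) * (C * pairCount n)) := by
        have := (h n (by omega)).2
        gcongr
    _ = _ := by ring

/-- Dominated convergence: for fixed `k` the term tends to 0 because `log n` tends to infinity, and
the condition `2 * k ≤ n` gives a geometric bound uniform in `n`. -/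
lemma tendsto_tsum_splitWeight :
    Filter.Tendsto (fun n => ∑' k, splitWeight n k) Filter.atTop (nhds 0) := by
  obtain ⟨C, hC, h⟩ := splitWeight_le
  have hl2 : 0 < Real.log 2 := Real.log_pos (by norm_num)
  -- Since `log k - log n ≤ -log 2`, the main term is at most `-2 * e * k`; half of this absorbs `3
  -- * k ^ (2 / 3)` and the other half gives the geometric series.
  set e := Real.log 2 / 12 with he
  have he0 : 0 < e := by positivity
  set M := 27 / e ^ 2
  have hsum : Summable (fun k : ℕ => C * Real.exp M * Real.exp (-e) ^ k) :=
    (summable_geometric_of_lt_one (Real.exp_pos _).le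
      (Real.exp_lt_one_iff.2 (by linarith))).mul_left _
  have key := tendsto_tsum_of_dominated_convergence (f := splitWeight) (g := fun _ => 0)
    (𝓕 := Filter.atTop) hsum ?_ ?_
  · simpa using key
  · intro k
    rcases Nat.eq_zero_or_pos k with rfl | hk
    · refine tendsto_const_nhds.congr fun n => ?_
      simp [splitWeight]
    have hk0 : (0 : ℝ) < k := by exact_mod_cast hk
    have hlim : Filter.Tendsto (fun n : ℕ => C * Real.exp (k / 6 * (Real.log k - Real.log n)
        + 3 * (k : ℝ) ^ ((2 : ℝ) / 3))) Filter.atTop (nhds 0) := by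
      rw [← mul_zero C]
      refine Filter.Tendsto.const_mul C (Real.tendsto_exp_atBot.comp ?_)
      refine Filter.tendsto_atBot_add_const_right _ _ ?_
      refine Filter.Tendsto.const_mul_atBot (by positivity) ?_
      exact Filter.tendsto_atBot_add_const_left _ _
        (Filter.tendsto_neg_atTop_atBot.comp
          (Real.tendsto_log_atTop.comp tendsto_natCast_atTop_atTop))
    refine squeeze_zero' (Filter.Eventually.of_forall fun n => splitWeight_nonneg n k) ?_ hlim
    filter_upwards [Filter.eventually_ge_atTop (2 * k)] with n hn
    exact h n k hk hn
  · refine Filter.Eventually.of_forall fun n k => ?_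
    rw [Real.norm_of_nonneg (splitWeight_nonneg n k)]
    by_cases hkn : 1 ≤ k ∧ 2 * k ≤ n
    · obtain ⟨hk, hkn⟩ := hkn
      refine (h n k hk hkn).trans ?_
      rw [mul_assoc, ← Real.exp_nat_mul, ← Real.exp_add]
      refine mul_le_mul_of_nonneg_left (Real.exp_le_exp.2 ?_) hC.le
      have hk0 : (0 : ℝ) < k := by exact_mod_cast hk
      have h1 : Real.log 2 + Real.log k ≤ Real.log n := by
        rw [← Real.log_mul (by norm_num) hk0.ne']
        exact Real.log_le_log (by positivity) (by exact_mod_cast hkn)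
      have h2 := three_mul_rpow_le k he0
      have h3 : (k : ℝ) / 6 * (Real.log k - Real.log n) ≤ k / 6 * (-(12 * e)) := by
        refine mul_le_mul_of_nonneg_left ?_ (by positivity)
        rw [he]; linarith
      change _ ≤ M + (k : ℝ) * -e
      linarith
    · rw [splitWeight, if_neg hkn]; positivity

/-- `splitWeight` covers only `k ≤ n / 2`; the reflection `k ↦ n - k` accounts for the rest and for
the factor 2. -/
lemma sum_pairCount_mul_le (n : ℕ) :
    ∑ k ∈ Finset.Ioo 0 n, pairCount k * pairCount (n - k) ≤
      2 * (∑' k, splitWeight n k) * pairCount n := by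
  have p := pairCount_pos
  have hts : ∑' k, splitWeight n k = ∑ k ∈ Finset.Ioo 0 n, splitWeight n k := by
    refine tsum_eq_sum fun k hk => ?_
    rw [splitWeight, if_neg]
    simp only [Finset.mem_Ioo] at hk
    omega
  have hrefl : ∑ k ∈ Finset.Ioo 0 n, splitWeight n (n - k) =
      ∑ k ∈ Finset.Ioo 0 n, splitWeight n k := by
    refine Finset.sum_nbij' (fun k => n - k) (fun k => n - k) ?_ ?_ ?_ ?_ ?_
    all_goals simp only [Finset.mem_Ioo]
    all_goals intros
    all_goals first | omega | rfl | trivial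
  have hle : ∀ k ∈ Finset.Ioo 0 n, pairCount k * pairCount (n - k) ≤
      (splitWeight n k + splitWeight n (n - k)) * pairCount n := by
    intro k hk
    rw [Finset.mem_Ioo] at hk
    rcases le_total (2 * k) n with h | h
    · have := splitWeight_nonneg n (n - k)
      calc _ = splitWeight n k * pairCount n := by
            rw [splitWeight, if_pos ⟨hk.1, h⟩, div_mul_cancel₀ _ (p n).ne']
        _ ≤ _ := mul_le_mul_of_nonneg_right (by linarith) (p n).le
    · have := splitWeight_nonneg n k
      calc _ = splitWeight n (n - k) * pairCount n := by
            rw [splitWeight, if_pos ⟨by omega, by omega⟩, div_mul_cancel₀ _ (p n).ne',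
              Nat.sub_sub_self hk.2.le, mul_comm]
        _ ≤ _ := mul_le_mul_of_nonneg_right (by linarith) (p n).le
  refine (Finset.sum_le_sum hle).trans (le_of_eq ?_)
  rw [← Finset.sum_mul, Finset.sum_add_distrib, hrefl, hts]
  ring

lemma eventually_sum_pairCount_mul_le : ∀ᶠ n : ℕ in Filter.atTop,
    ∑ k ∈ Finset.Ioo 0 n, pairCount k * pairCount (n - k) ≤ pairCount n / 2 := by
  have h := tendsto_tsum_splitWeight.eventually (gt_mem_nhds (show (0 : ℝ) < 1 / 4 by norm_num))
  filter_upwards [h] with n hn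
  refine (sum_pairCount_mul_le n).trans ?_
  nlinarith [pairCount_pos n]

lemma mul_pairGrowth_eq {n : ℕ} (hn : 1 ≤ n) :
    (n : ℝ) * pairGrowth n = (n : ℝ) ^ ((n : ℝ) / 6 + 1 / 2) *
        Real.exp (-((n : ℝ) / 6) + (n : ℝ) ^ ((2 : ℝ) / 3) + (n : ℝ) ^ ((1 : ℝ) / 2)
          + 1 / 3 * (n : ℝ) ^ ((1 : ℝ) / 3)) := by
  have hn0 : (0 : ℝ) < n := by exact_mod_cast hn
  unfold pairGrowth
  rw [mul_div_assoc', mul_div_right_comm, Real.div_sqrt, Real.rpow_add hn0, ← Real.sqrt_eq_rpow,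
    mul_comm _ (√(n : ℝ)), mul_assoc]
  congr 1
  rw [Real.rpow_def_of_pos hn0 ((n : ℝ) / 6), ← Real.exp_add]
  congr 1
  ring

/-! ### Words -/

lemma mk_neg_one : (QuotientGroup.mk (-1 : Matrix.SpecialLinearGroup (Fin 2) ℤ) : PSL2Z) = 1 := by
  rw [QuotientGroup.eq_one_iff, Matrix.SpecialLinearGroup.mem_center_iff]
  exact ⟨-1, by norm_num, by ext i j; fin_cases i <;> fin_cases j <;> simp⟩

lemma eq_one_or_neg_one_of_mk {M : Matrix.SpecialLinearGroup (Fin 2) ℤ}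
    (h : (QuotientGroup.mk M : PSL2Z) = 1) : M = 1 ∨ M = -1 := by
  rw [QuotientGroup.eq_one_iff, Matrix.SpecialLinearGroup.mem_center_iff] at h
  obtain ⟨r, hr, h⟩ := h
  simp only [Fintype.card_fin] at hr
  rcases eq_or_eq_neg_of_sq_eq_sq r 1 (by simpa using hr) with rfl | rfl
  · left; ext i j; rw [← h]; simp
  · right; ext i j; rw [← h]; fin_cases i <;> fin_cases j <;> simp

lemma val_a_mul_self : Gen.a.val * Gen.a.val = 1 := by
  rw [← mk_neg_one]
  change QuotientGroup.mk (ModularGroup.S * ModularGroup.S) = _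
  congr 1
  ext i j; fin_cases i <;> fin_cases j <;> simp [ModularGroup.coe_S]

lemma val_b_mul_self_mul_self : Gen.b.val * Gen.b.val * Gen.b.val = 1 := by
  rw [← mk_neg_one]
  change QuotientGroup.mk ((ModularGroup.S * ModularGroup.T) * (ModularGroup.S * ModularGroup.T) *
    (ModularGroup.S * ModularGroup.T)) = _
  congr 1
  ext i j; fin_cases i <;> fin_cases j <;> simp [ModularGroup.coe_S, ModularGroup.coe_T, Matrix.mul_apply]

@[simp] lemma wordVal_nil : wordVal [] = 1 := rfl

@[simp] lemma wordVal_cons (l : Gen × Bool) (w : Word) :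
    wordVal (l :: w) = letterVal l * wordVal w := by
  simp [wordVal]

@[simp] lemma wordVal_append (u v : Word) : wordVal (u ++ v) = wordVal u * wordVal v := by
  simp [wordVal]

lemma letterVal_a (s : Bool) : letterVal (.a, s) = Gen.a.val := by
  cases s
  · simp [letterVal, inv_eq_of_mul_eq_one_left val_a_mul_self]
  · simp [letterVal]

/-- The formal inverse of a letter. -/
def invLetter (l : Gen × Bool) : Gen × Bool := (l.1, !l.2)

/-- The formal inverse of a word. -/
def invWord (w : Word) : Word := (w.map invLetter).reverse

lemma letterVal_invLetter (l : Gen × Bool) : letterVal (invLetter l) = (letterVal l)⁻¹ := by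
  obtain ⟨c, s⟩ := l
  cases s <;> simp [letterVal, invLetter]

@[simp] lemma invWord_nil : invWord [] = [] := rfl

@[simp] lemma invWord_cons (l : Gen × Bool) (w : Word) :
    invWord (l :: w) = invWord w ++ [invLetter l] := by
  simp [invWord]

@[simp] lemma wordVal_invWord (w : Word) : wordVal (invWord w) = (wordVal w)⁻¹ := by
  induction w with
  | nil => simp
  | cons l w ih => simp [ih, letterVal_invLetter]

lemma map_fst_invWord (w : Word) : (invWord w).map Prod.fst = (w.map Prod.fst).reverse := by
  simp [invWord, invLetter, Function.comp_def]

lemma letterVal_b_mul (s : Bool) :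
    letterVal (.b, s) * letterVal (.b, s) = letterVal (.b, !s) := by
  have h := val_b_mul_self_mul_self
  have h' : Gen.b.val * Gen.b.val = Gen.b.val⁻¹ := eq_inv_of_mul_eq_one_left h
  cases s
  · simp [letterVal, ← mul_inv_rev, h']
  · simp [letterVal, h']

lemma exists_wordVal_eq (g : PSL2Z) : ∃ w : Word, wordVal w = g := by
  obtain ⟨M, rfl⟩ := QuotientGroup.mk_surjective g
  have hM : M ∈ Subgroup.closure {ModularGroup.S, ModularGroup.T} := by
    simp [SpecialLinearGroup.SL2Z_generators]
  induction hM using Subgroup.closure_induction with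
  | mem x hx =>
    rcases hx with rfl | rfl
    · exact ⟨[(.a, true)], by simp [letterVal, Gen.val]⟩
    · exact ⟨[(.a, false), (.b, true)], by simp [letterVal, Gen.val]⟩
  | one => exact ⟨[], rfl⟩
  | mul x y _ _ hx hy =>
    obtain ⟨u, hu⟩ := hx
    obtain ⟨v, hv⟩ := hy
    exact ⟨u ++ v, by simp [hu, hv]⟩
  | inv x _ hx =>
    obtain ⟨u, hu⟩ := hx
    exact ⟨invWord u, by simp [hu]⟩

/-! ### Ping-pong on integer vectors and uniqueness of reduced words. -/

/-- The action of a letter on integer vectors. -/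
def letterAct (l : Gen × Bool) (v : ℤ × ℤ) : ℤ × ℤ :=
  match l with
  | (.a, true) => (-v.2, v.1)
  | (.a, false) => (v.2, -v.1)
  | (.b, true) => (-v.2, v.1 + v.2)
  | (.b, false) => (v.1 + v.2, -v.1)

/-- The action of a word on integer vectors. -/
def wordAct (w : Word) (v : ℤ × ℤ) : ℤ × ℤ := w.foldr letterAct v

lemma exists_lift_letter (l : Gen × Bool) : ∃ M : Matrix.SpecialLinearGroup (Fin 2) ℤ,
    (QuotientGroup.mk M : PSL2Z) = letterVal l ∧
      ∀ v, (M 0 0 * v.1 + M 0 1 * v.2, M 1 0 * v.1 + M 1 1 * v.2) = letterAct l v := by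
  obtain ⟨c, s⟩ := l
  cases c <;> cases s
  · refine ⟨ModularGroup.S⁻¹, by simp [letterVal, Gen.val], fun v => ?_⟩
    simp [letterAct, ModularGroup.coe_S, Matrix.SpecialLinearGroup.coe_inv, Matrix.adjugate_fin_two]
  · refine ⟨ModularGroup.S, by simp [letterVal, Gen.val], fun v => ?_⟩
    simp [letterAct, ModularGroup.coe_S]
  · refine ⟨(ModularGroup.S * ModularGroup.T)⁻¹, by simp [letterVal, Gen.val], fun v => ?_⟩
    simp [letterAct, ModularGroup.coe_S, ModularGroup.coe_T, Matrix.SpecialLinearGroup.coe_inv,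
      Matrix.adjugate_fin_two]
  · refine ⟨ModularGroup.S * ModularGroup.T, by simp [letterVal, Gen.val], fun v => ?_⟩
    simp [letterAct, ModularGroup.coe_S, ModularGroup.coe_T]

lemma exists_lift_word (w : Word) : ∃ M : Matrix.SpecialLinearGroup (Fin 2) ℤ,
    (QuotientGroup.mk M : PSL2Z) = wordVal w ∧
      ∀ v, (M 0 0 * v.1 + M 0 1 * v.2, M 1 0 * v.1 + M 1 1 * v.2) = wordAct w v := by
  induction w with
  | nil => exact ⟨1, rfl, fun v => by simp [wordAct]⟩
  | cons l w ih =>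
    obtain ⟨M, hM, hv⟩ := ih
    obtain ⟨L, hL, hl⟩ := exists_lift_letter l
    refine ⟨L * M, by simp [← hM, ← hL], fun v => ?_⟩
    rw [wordAct, List.foldr_cons, ← wordAct, ← hv, ← hl]
    simp only [Matrix.SpecialLinearGroup.coe_mul, Matrix.mul_apply, Fin.sum_univ_two]
    ext <;> dsimp only <;> ring

/-- The projective group acts on vectors only up to sign. The ping-pong sets and `height` are
invariant under negation, so this ambiguity is harmless. -/
lemma wordAct_eq_of_wordVal_eq_one {w : Word} (h : wordVal w = 1) (v : ℤ × ℤ) :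
    wordAct w v = v ∨ wordAct w v = -v := by
  obtain ⟨M, hM, hv⟩ := exists_lift_word w
  rw [h] at hM
  rcases eq_one_or_neg_one_of_mk hM with rfl | rfl
  · left; rw [← hv]; simp
  · right; rw [← hv]; ext <;> simp

/-- The vectors that arise by the action of a reduced word that begins with the letter `c`. -/
def PingPong (c : Gen) (v : ℤ × ℤ) : Prop :=
  match c with
  | .a => 0 < v.1 * v.2
  | .b => v.1 * v.2 < 0

lemma PingPong.neg {c : Gen} {v : ℤ × ℤ} (h : PingPong c v) : PingPong c (-v) := by
  cases c <;> simpa [PingPong] using h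

lemma PingPong.unique {c d : Gen} {v : ℤ × ℤ} (hc : PingPong c v) (hd : PingPong d v) :
    c = d := by
  cases c <;> cases d <;> simp only [PingPong] at hc hd <;> first | rfl | omega

lemma exists_pingPong (c : Gen) : ∃ v, PingPong c v := by
  cases c
  · exact ⟨(1, 1), by simp [PingPong]⟩
  · exact ⟨(1, -1), by simp [PingPong]⟩

/-- The size of an integer vector. -/
def height (v : ℤ × ℤ) : ℤ := |v.1| + |v.2|

lemma height_neg (v : ℤ × ℤ) : height (-v) = height v := by simp [height]

/-- The letter `a` exchanges coordinates and changes one sign. When both coordinates have the same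
sign, `b` and its inverse replace one of them by the sum, which gives opposite signs and a larger
height. -/
lemma pingPong_letterAct {c d : Gen} (hcd : c ≠ d) (s : Bool) {v : ℤ × ℤ} (hv : PingPong d v) :
    PingPong c (letterAct (c, s) v) ∧ height v ≤ height (letterAct (c, s) v) ∧
      (c = .b → height v < height (letterAct (c, s) v)) := by
  obtain ⟨p, q⟩ := v
  cases c <;> cases d <;> simp only [ne_eq, not_true_eq_false, reduceCtorEq] at hcd
  · simp only [PingPong] at hv
    cases s <;> simp [PingPong, letterAct, height] <;> constructor <;> linarith [abs_nonneg p]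
  · simp only [PingPong] at hv
    rcases mul_pos_iff.1 hv with ⟨hp, hq⟩ | ⟨hp, hq⟩
    · cases s <;> simp [PingPong, letterAct, height, abs_of_pos hp, abs_of_pos hq,
        abs_of_pos (add_pos hp hq)] <;> (repeat' apply And.intro) <;> nlinarith
    · cases s <;> simp [PingPong, letterAct, height, abs_of_neg hp, abs_of_neg hq,
        abs_of_neg (add_neg hp hq)] <;> (repeat' apply And.intro) <;> nlinarith

/-- Words in which the letters `a` and `b` alternate. -/
def Reduced (w : Word) : Prop := (w.map Prod.fst).IsChain (· ≠ ·)

/-- The type of the first letter of a word, or a default value. -/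
def headType (w : Word) (c : Gen) : Gen :=
  match w with
  | [] => c
  | l :: _ => l.1

lemma pingPong_wordAct {c : Gen} {v : ℤ × ℤ} (hv : PingPong c v) (w : Word)
    (hw : (w.map Prod.fst ++ [c]).IsChain (· ≠ ·)) :
    PingPong (headType w c) (wordAct w v) ∧ height v ≤ height (wordAct w v) ∧
      ((∃ l ∈ w, l.1 = .b) → height v < height (wordAct w v)) := by
  induction w with
  | nil => simpa [headType, wordAct] using hv
  | cons l w ih =>
    obtain ⟨h1, h2, h3⟩ := ih hw.tail
    have hne : l.1 ≠ headType w c := by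
      cases w with
      | nil => simpa [headType] using hw
      | cons l' w => simp [headType] at hw ⊢; exact hw.1
    obtain ⟨k1, k2, k3⟩ := pingPong_letterAct hne l.2 h1
    refine ⟨k1, h2.trans k2, ?_⟩
    rintro ⟨l', hl', hb⟩
    rcases List.mem_cons.1 hl' with rfl | hl'
    · exact h2.trans_lt (k3 hb)
    · exact (h3 ⟨l', hl', hb⟩).trans_le k2

lemma Gen.exists_ne (c : Gen) : ∃ d : Gen, c ≠ d := by
  cases c
  · exact ⟨.b, by simp⟩
  · exact ⟨.a, by simp⟩

/-- The two sets alone do not exclude words that begin and end with different letters, since these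
may return a vector to its own set. The height excludes every word containing `b`; without `b`, the
word moves a vector from one set to the other. -/
lemma Reduced.eq_nil {w : Word} (hw : Reduced w) (h : wordVal w = 1) : w = [] := by
  by_contra hne
  obtain ⟨c, hc⟩ := (w.getLast hne).1.exists_ne
  obtain ⟨v, hv⟩ := exists_pingPong c
  have hchain : (w.map Prod.fst ++ [c]).IsChain (· ≠ ·) := by
    refine List.isChain_append.2 ⟨hw, by simp, ?_⟩
    intro x hx y hy
    simp only [List.head?_cons, Option.mem_def, Option.some.injEq] at hy
    subst hy
    rw [List.getLast?_map, List.getLast?_eq_getLast_of_ne_nil hne] at hx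
    simp only [Option.map_some, Option.mem_def, Option.some.injEq] at hx
    rwa [← hx]
  obtain ⟨h1, h2, h3⟩ := pingPong_wordAct hv w hchain
  by_cases hb : ∃ l ∈ w, l.1 = .b
  · have := h3 hb
    rcases wordAct_eq_of_wordVal_eq_one h v with h4 | h4 <;> rw [h4] at this
    · exact lt_irrefl _ this
    · rw [height_neg] at this; exact lt_irrefl _ this
  · push Not at hb
    have ha : ∀ l ∈ w, l.1 = .a := fun l hl => by
      have := hb l hl
      cases h : l.1 <;> simp_all
    have hca : c ≠ .a := by
      rw [← ha _ (List.getLast_mem hne)]; exact hc.symm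
    have hh : headType w c = .a := by
      cases w with
      | nil => exact absurd rfl hne
      | cons l w => exact ha l (by simp)
    rw [hh] at h1
    rcases wordAct_eq_of_wordVal_eq_one h v with h4 | h4 <;> rw [h4] at h1
    · exact hca (hv.unique h1)
    · exact hca (hv.neg.unique h1)

/-- Replaces the inverse of the letter `a` by `a`. -/
def normLetter (l : Gen × Bool) : Gen × Bool :=
  match l with
  | (.a, _) => (.a, true)
  | (.b, s) => (.b, s)

lemma letterVal_normLetter (l : Gen × Bool) : letterVal (normLetter l) = letterVal l := by
  obtain ⟨c, s⟩ := l
  cases c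
  · simp [normLetter, letterVal_a]
  · rfl

/-- Normal form in the free product. Reduced words are unique only up to replacing `a` by its formal
inverse, because both letters have the same value. If the first letters differ, a nonempty reduced
word of value 1 arises from the inverse of one word followed by the other. -/
theorem Reduced.map_normLetter_eq {u v : Word} (hu : Reduced u) (hv : Reduced v)
    (h : wordVal u = wordVal v) : u.map normLetter = v.map normLetter := by
  induction u generalizing v with
  | nil => rw [hv.eq_nil h.symm]
  | cons l u ih =>
    cases v with
    | nil => rw [hu.eq_nil h]
    | cons l' v =>
      by_cases hl : normLetter l = normLetter l'
      · have hval : letterVal l = letterVal l' := by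
          rw [← letterVal_normLetter, hl, letterVal_normLetter]
        simp only [wordVal_cons, hval, mul_right_inj] at h
        rw [List.map_cons, List.map_cons, hl, ih hu.tail hv.tail h]
      · exfalso
        by_cases hfst : l.1 = l'.1
        · obtain ⟨c, s⟩ := l
          obtain ⟨c', s'⟩ := l'
          obtain rfl : c = c' := hfst
          cases c
          · exact hl rfl
          · obtain rfl : s' = !s := by
              have : s ≠ s' := fun hs => hl (by rw [hs])
              cases s <;> cases s' <;> simp_all
            -- When the first letters are `b` and its inverse, they merge at the junction into a
            -- single power of `b`, because `b ^ 3 = 1`.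
            have hred : Reduced (invWord u ++ (.b, s) :: v) := by
              have h1 : (((u.map Prod.fst).reverse) ++ [Gen.b]).IsChain (· ≠ ·) := by
                have := List.isChain_reverse.2 (hu.imp fun _ _ => Ne.symm)
                simpa [flip] using this
              have h2 : ([Gen.b] ++ v.map Prod.fst).IsChain (· ≠ ·) := hv
              have := h1.append_overlap h2 (by simp)
              rw [Reduced, List.map_append, map_fst_invWord]
              simpa using this
            have hval : wordVal (invWord u ++ (.b, s) :: v) = 1 := by
              have h1 := letterVal_b_mul s
              simp only [wordVal_cons] at h
              rw [← h1] at h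
              have h2 : wordVal u = letterVal (.b, s) * wordVal v := by
                rw [mul_assoc] at h; exact mul_left_cancel h
              simp [h2]
            simpa using hred.eq_nil hval
        · have hred : Reduced (invWord (l :: u) ++ l' :: v) := by
            rw [Reduced, List.map_append, map_fst_invWord]
            refine List.isChain_append.2 ⟨?_, hv, ?_⟩
            · have := List.isChain_reverse.2 (hu.imp fun _ _ => Ne.symm)
              simpa [flip] using this
            · intro x hx y hy
              simp at hx hy
              rwa [← hx, ← hy]
          have hval : wordVal (invWord (l :: u) ++ l' :: v) = 1 := by
            rw [wordVal_append, wordVal_invWord, h, inv_mul_cancel]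
          simpa using hred.eq_nil hval

/-! ### Partial actions and paths -/

/-- The relations `A` and `R` describe the partial action of the letters `a` and `b` on a set of
points; three consecutive points of a `b`-path lie on a triangle or on a loop. -/
structure IsPartialAction {X : Type} (A R : X → X → Prop) : Prop where
  a_symm : ∀ {x y}, A x y → A y x
  a_unique : ∀ {x y z}, A x y → A x z → y = z
  b_unique : ∀ {x y z}, R x y → R x z → y = z
  b_injective : ∀ {x y z}, R x z → R y z → x = y
  b_triangle : ∀ {x y z}, R x y → R y z → R z x

/-- The step along a letter. -/
def Step {X : Type} (A R : X → X → Prop) (l : Gen × Bool) (x y : X) : Prop :=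
  match l with
  | (.a, _) => A x y
  | (.b, true) => R x y
  | (.b, false) => R y x

/-- The word `w` leads from `x` to `y`. -/
def Path {X : Type} (A R : X → X → Prop) : Word → X → X → Prop
  | [], x, y => x = y
  | l :: w, x, y => ∃ z, Step A R l x z ∧ Path A R w z y

lemma path_append {X : Type} {A R : X → X → Prop} {u v : Word} {x y : X} :
    Path A R (u ++ v) x y ↔ ∃ z, Path A R u x z ∧ Path A R v z y := by
  induction u generalizing x with
  | nil => simp [Path]
  | cons l u ih =>
    simp only [List.cons_append, Path, ih]
    constructor
    · rintro ⟨z, h1, t, h2, h3⟩; exact ⟨t, ⟨z, h1, h2⟩, h3⟩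
    · rintro ⟨t, ⟨z, h1, h2⟩, h3⟩; exact ⟨z, h1, t, h2, h3⟩

lemma path_singleton {X : Type} {A R : X → X → Prop} {l : Gen × Bool} {x y : X} :
    Path A R [l] x y ↔ Step A R l x y := by
  simp [Path]

lemma step_normLetter {X : Type} {A R : X → X → Prop} {l : Gen × Bool} {x y : X} :
    Step A R (normLetter l) x y ↔ Step A R l x y := by
  obtain ⟨c, s⟩ := l
  cases c <;> rfl

lemma path_map_normLetter {X : Type} {A R : X → X → Prop} {w : Word} {x y : X} :
    Path A R (w.map normLetter) x y ↔ Path A R w x y := by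
  induction w generalizing x with
  | nil => rfl
  | cons l w ih => simp only [List.map_cons, Path, step_normLetter, ih]

namespace IsPartialAction

variable {X : Type} {A R : X → X → Prop}

lemma step_unique (h : IsPartialAction A R) {l : Gen × Bool} {x y z : X} (h1 : Step A R l x y)
    (h2 : Step A R l x z) : y = z := by
  obtain ⟨c, s⟩ := l
  cases c
  · exact h.a_unique h1 h2
  · cases s
    · exact h.b_injective h1 h2
    · exact h.b_unique h1 h2

lemma path_unique (h : IsPartialAction A R) {w : Word} {x y z : X} (h1 : Path A R w x y)
    (h2 : Path A R w x z) : y = z := by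
  induction w generalizing x with
  | nil => exact h1.symm.trans h2
  | cons l w ih =>
    obtain ⟨t, ht, h1⟩ := h1
    obtain ⟨s, hs, h2⟩ := h2
    obtain rfl := h.step_unique ht hs
    exact ih h1 h2

lemma step_invLetter (h : IsPartialAction A R) {l : Gen × Bool} {x y : X}
    (h1 : Step A R l x y) : Step A R (invLetter l) y x := by
  obtain ⟨c, s⟩ := l
  cases c
  · exact h.a_symm h1
  · cases s <;> exact h1

lemma path_invWord (h : IsPartialAction A R) {w : Word} {x y : X} (h1 : Path A R w x y) :
    Path A R (invWord w) y x := by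
  induction w generalizing x with
  | nil => exact h1.symm
  | cons l w ih =>
    obtain ⟨t, ht, h1⟩ := h1
    rw [invWord_cons, path_append]
    exact ⟨t, ih h1, path_singleton.2 (h.step_invLetter ht)⟩

end IsPartialAction

/-! ### Reduction of words along paths; geodesic means reduced. -/

/-- The replacement is valid in every partial action, not only in the group: the rule `bb = b⁻¹` is
what `b_triangle` provides. -/
lemma exists_shorter_of_fst_eq (l l' : Gen × Bool) (h : l.1 = l'.1) :
    ∃ s : Word, s.length ≤ 1 ∧ wordVal s = letterVal l * letterVal l' ∧
      ∀ (X : Type) (A R : X → X → Prop), IsPartialAction A R → ∀ x y z,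
        Step A R l x y → Step A R l' y z → Path A R s x z := by
  obtain ⟨c, s⟩ := l
  obtain ⟨c', s'⟩ := l'
  obtain rfl : c = c' := h
  cases c
  · refine ⟨[], by simp, ?_, ?_⟩
    · simp [letterVal_a, val_a_mul_self]
    · intro X A R hA x y z h1 h2
      exact hA.a_unique (hA.a_symm h1) h2
  · by_cases hs : s = s'
    · subst hs
      refine ⟨[(.b, !s)], by simp, by simp [letterVal_b_mul], ?_⟩
      intro X A R hA x y z h1 h2
      rw [path_singleton]
      cases s
      · exact hA.b_triangle h2 h1
      · exact hA.b_triangle h1 h2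
    · obtain rfl : s' = !s := by cases s <;> cases s' <;> simp_all
      refine ⟨[], by simp, ?_, ?_⟩
      · have := letterVal_invLetter (.b, s)
        simp only [invLetter] at this
        simp [this]
      · intro X A R hA x y z h1 h2
        cases s
        · exact hA.b_unique h1 h2
        · exact hA.b_injective h1 h2

lemma exists_shorter {w : Word} (hw : ¬ Reduced w) :
    ∃ w' : Word, w'.length < w.length ∧ wordVal w' = wordVal w ∧
      ∀ (X : Type) (A R : X → X → Prop), IsPartialAction A R → ∀ x y,
        Path A R w x y → Path A R w' x y := by
  rw [Reduced, List.isChain_map, List.isChain_iff_forall_rel_of_append_cons_cons] at hw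
  push Not at hw
  obtain ⟨l, l', u, v, rfl, h⟩ := hw
  obtain ⟨s, hs, hval, hpath⟩ := exists_shorter_of_fst_eq l l' h
  refine ⟨u ++ s ++ v, ?_, by simp [hval, mul_assoc], ?_⟩
  · simp only [List.length_append, List.length_cons]; omega
  · intro X A R hA x y h1
    obtain ⟨z, h1, t, h2, t', h3, h4⟩ := path_append.1 h1
    rw [path_append]
    exact ⟨t', path_append.2 ⟨z, h1, hpath X A R hA z t t' h2 h3⟩, h4⟩

lemma exists_reduced (w : Word) :
    ∃ w' : Word, Reduced w' ∧ w'.length ≤ w.length ∧ wordVal w' = wordVal w ∧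
      ∀ (X : Type) (A R : X → X → Prop), IsPartialAction A R → ∀ x y,
        Path A R w x y → Path A R w' x y := by
  induction hn : w.length using Nat.strong_induction_on generalizing w with
  | _ n ih =>
    by_cases hw : Reduced w
    · exact ⟨w, hw, hn.le, rfl, fun _ _ _ _ _ _ h => h⟩
    · obtain ⟨w₁, h1, h2, h3⟩ := exists_shorter hw
      obtain ⟨w₂, k1, k2, k3, k4⟩ := ih _ (hn ▸ h1) w₁ rfl
      exact ⟨w₂, k1, by omega, k3.trans h2, fun X A R hA x y h => k4 X A R hA x y
        (h3 X A R hA x y h)⟩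

lemma IsGeodesic.reduced {w : Word} (hw : IsGeodesic w) : Reduced w := by
  by_contra h
  obtain ⟨w', h1, h2, -⟩ := exists_shorter h
  exact absurd (hw w' h2) (by omega)

lemma Reduced.isGeodesic {w : Word} (hw : Reduced w) : IsGeodesic w := by
  intro w' h
  obtain ⟨w₁, h1, h2, h3, -⟩ := exists_reduced w'
  have := congrArg List.length (hw.map_normLetter_eq h1 (h.symm.trans h3.symm))
  simp only [List.length_map] at this
  omega

lemma exists_isGeodesic (g : PSL2Z) : ∃ w : Word, IsGeodesic w ∧ wordVal w = g := by
  obtain ⟨w, rfl⟩ := exists_wordVal_eq g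
  obtain ⟨w', h1, -, h2, -⟩ := exists_reduced w
  exact ⟨w', h1.isGeodesic, h2⟩

lemma IsPartialAction.path_of_reduced {X : Type} {A R : X → X → Prop} (h : IsPartialAction A R)
    {w w' : Word} (hw' : Reduced w') (hval : wordVal w' = wordVal w) {x y : X}
    (hp : Path A R w x y) : Path A R w' x y := by
  obtain ⟨w₁, h1, -, h2, h3⟩ := exists_reduced w
  rw [← path_map_normLetter, hw'.map_normLetter_eq h1 (hval.trans h2.symm), path_map_normLetter]
  exact h3 X A R h x y hp

lemma IsPartialAction.path_unique_of_wordVal_eq {X : Type} {A R : X → X → Prop}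
    (h : IsPartialAction A R) {w w' : Word} (hval : wordVal w' = wordVal w) {x y z : X}
    (hp : Path A R w x y) (hp' : Path A R w' x z) : y = z := by
  obtain ⟨w₁, h1, -, h2, h3⟩ := exists_reduced w
  exact h.path_unique (h3 X A R h x y hp) (h.path_of_reduced h1 (h2.trans hval.symm) hp')

/-! ### Cosets -/

lemma coset_eq_iff {H : Subgroup PSL2Z} {g g' : PSL2Z} :
    coset H g = coset H g' ↔ g' * g⁻¹ ∈ H := by
  rw [coset, coset, Quotient.eq, QuotientGroup.rightRel_apply]

/-- Right multiplication of cosets. -/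
def cosetMul (H : Subgroup PSL2Z) (x : Cosets H) (g : PSL2Z) : Cosets H :=
  Quotient.map (· * g) (fun _ _ h => by
    change QuotientGroup.rightRel H _ _ at h
    change QuotientGroup.rightRel H _ _
    rw [QuotientGroup.rightRel_apply] at h ⊢
    simpa [mul_assoc] using h) x

@[simp] lemma cosetMul_coset (H : Subgroup PSL2Z) (g g' : PSL2Z) :
    cosetMul H (coset H g) g' = coset H (g * g') := rfl

lemma exists_eq_coset (H : Subgroup PSL2Z) (x : Cosets H) : ∃ g, x = coset H g :=
  ⟨x.out, (Quotient.out_eq x).symm⟩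

lemma cosetMul_mul (H : Subgroup PSL2Z) (x : Cosets H) (g g' : PSL2Z) :
    cosetMul H x (g * g') = cosetMul H (cosetMul H x g) g' := by
  obtain ⟨h, rfl⟩ := exists_eq_coset H x
  simp [mul_assoc]

@[simp] lemma cosetMul_one (H : Subgroup PSL2Z) (x : Cosets H) : cosetMul H x 1 = x := by
  obtain ⟨h, rfl⟩ := exists_eq_coset H x
  simp

lemma coset_eq_one_iff {H : Subgroup PSL2Z} {g : PSL2Z} : coset H g = coset H 1 ↔ g ∈ H := by
  rw [eq_comm, coset_eq_iff, inv_one, mul_one]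

/-! ### Saturated structures -/

/-- Every point has exactly one partner; the relation is the graph of an involution. -/
structure IsInvolutive {X : Type} (A : X → X → Prop) : Prop where
  symm : ∀ {x y}, A x y → A y x
  unique : ∀ {x y z}, A x y → A x z → y = z
  total : ∀ x, ∃ y, A x y

/-- The components of the relation are loops, edges and oriented triangles. -/
structure IsTriangular {X : Type} (R : X → X → Prop) : Prop where
  unique : ∀ {x y z}, R x y → R x z → y = z
  injective : ∀ {x y z}, R x z → R y z → x = y
  triangle : ∀ {x y z}, R x y → R y z → R z x
  total : ∀ x, ∃ y, R x y ∨ R y x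

lemma IsInvolutive.isPartialAction {X : Type} {A R : X → X → Prop} (hA : IsInvolutive A)
    (hR : IsTriangular R) : IsPartialAction A R :=
  ⟨hA.symm, hA.unique, hR.unique, hR.injective, hR.triangle⟩

/-- No edge begins or ends at `r`. -/
def IsIsolated {X : Type} (r : X) (R : X → X → Prop) : Prop := ∀ z, ¬ R r z ∧ ¬ R z r

/-- Adds a loop at `r` if no edge begins or ends there. -/
def addLoop {X : Type} (r : X) (R : X → X → Prop) (x y : X) : Prop :=
  R x y ∨ (x = r ∧ y = r ∧ IsIsolated r R)

/-- An added loop cannot be told from a genuine one, hence the extra mark `IsIsolated`. -/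
lemma eq_of_addLoop_eq {X : Type} {r : X} {R R' : X → X → Prop}
    (h : addLoop r R = addLoop r R') (hi : IsIsolated r R = IsIsolated r R') : R = R' := by
  have key : ∀ {R R' : X → X → Prop}, addLoop r R = addLoop r R' →
      IsIsolated r R = IsIsolated r R' → ∀ x y, R x y → R' x y := by
    intro R R' h hi x y hxy
    have h1 : addLoop r R' x y := h ▸ Or.inl hxy
    rcases h1 with h1 | ⟨rfl, rfl, h2⟩
    · exact h1
    · rw [← hi] at h2
      exact absurd hxy (h2 _).1
  ext x y
  exact ⟨key h hi x y, key h.symm hi.symm x y⟩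

lemma IsPartialAction.isInvolutive_addLoop {X : Type} {A R : X → X → Prop}
    (h : IsPartialAction A R) {r : X} (hr : ∀ x, x ≠ r → ∃ y, A x y) :
    IsInvolutive (addLoop r A) where
  symm := by
    rintro x y (h1 | ⟨rfl, rfl, h1⟩)
    · exact Or.inl (h.a_symm h1)
    · exact Or.inr ⟨rfl, rfl, h1⟩
  unique := by
    rintro x y z (h1 | ⟨rfl, rfl, h1⟩) (h2 | ⟨h2, h3, h4⟩)
    · exact h.a_unique h1 h2
    · subst h2; exact absurd h1 (h4 _).1
    · exact absurd h2 (h1 _).1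
    · exact h3.symm
  total := by
    intro x
    by_cases hx : ∃ y, A x y
    · obtain ⟨y, hy⟩ := hx; exact ⟨y, Or.inl hy⟩
    · obtain rfl : x = r := by by_contra hxr; exact hx (hr x hxr)
      exact ⟨x, Or.inr ⟨rfl, rfl, fun z => ⟨fun hz => hx ⟨z, hz⟩, fun hz => hx ⟨z, h.a_symm hz⟩⟩⟩⟩

lemma IsPartialAction.isTriangular_addLoop {X : Type} {A R : X → X → Prop}
    (h : IsPartialAction A R) {r : X} (hr : ∀ x, x ≠ r → ∃ y, R x y ∨ R y x) :
    IsTriangular (addLoop r R) where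
  unique := by
    rintro x y z (h1 | ⟨rfl, rfl, h1⟩) (h2 | ⟨h2, h3, h4⟩)
    · exact h.b_unique h1 h2
    · subst h2; exact absurd h1 (h4 _).1
    · exact absurd h2 (h1 _).1
    · exact h3.symm
  injective := by
    rintro x y z (h1 | ⟨rfl, rfl, h1⟩) (h2 | ⟨h2, h3, h4⟩)
    · exact h.b_injective h1 h2
    · subst h3; exact absurd h1 (h4 _).2
    · exact absurd h2 (h1 _).2
    · exact h2.symm
  triangle := by
    rintro x y z (h1 | ⟨rfl, rfl, h1⟩) (h2 | ⟨h2, h3, h4⟩)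
    · exact Or.inl (h.b_triangle h1 h2)
    · subst h2; exact absurd h1 (h4 _).2
    · exact absurd h2 (h1 _).1
    · exact Or.inr ⟨h3, rfl, h1⟩
  total := by
    intro x
    by_cases hx : ∃ y, R x y ∨ R y x
    · obtain ⟨y, hy | hy⟩ := hx
      · exact ⟨y, Or.inl (Or.inl hy)⟩
      · exact ⟨y, Or.inr (Or.inl hy)⟩
    · obtain rfl : x = r := by by_contra hxr; exact hx (hr x hxr)
      exact ⟨x, Or.inl (Or.inr ⟨rfl, rfl, fun z =>
        ⟨fun hz => hx ⟨z, Or.inl hz⟩, fun hz => hx ⟨z, Or.inr hz⟩⟩⟩)⟩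

/-! ### The Stallings graph as a partial action -/

section Induced

variable {H : Subgroup PSL2Z} {V : Set (Cosets H)} {n : ℕ}

/-- Right multiplication by `g` on a numbered set of cosets. -/
def mulRel (f : V ≃ Fin n) (g : PSL2Z) (i j : Fin n) : Prop :=
  cosetMul H (f.symm i) g = f.symm j

lemma mulRel_symm {f : V ≃ Fin n} {g : PSL2Z} {i j : Fin n} (h : mulRel f g i j) :
    mulRel f g⁻¹ j i := by
  unfold mulRel at *
  rw [← h, ← cosetMul_mul, mul_inv_cancel, cosetMul_one]

lemma mulRel_unique {f : V ≃ Fin n} {g : PSL2Z} {i j k : Fin n} (h : mulRel f g i j)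
    (h' : mulRel f g i k) : j = k :=
  f.symm.injective (Subtype.ext (h.symm.trans h'))

lemma mulRel_mul {f : V ≃ Fin n} {g g' : PSL2Z} {i j k : Fin n} (h : mulRel f g i j)
    (h' : mulRel f g' j k) : mulRel f (g * g') i k := by
  unfold mulRel at *
  rw [cosetMul_mul, h, h']

/-- All Schreier edges between the numbered cosets are kept, whether or not a geodesic loop
traverses them; so two consecutive `b`-edges always close up to a triangle or a loop, by `b ^ 3 =
1`. -/
lemma isPartialAction_mulRel (f : V ≃ Fin n) :
    IsPartialAction (mulRel f Gen.a.val) (mulRel f Gen.b.val) where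
  a_symm h := by
    have := mulRel_symm h
    rwa [inv_eq_of_mul_eq_one_left val_a_mul_self] at this
  a_unique := mulRel_unique
  b_unique := mulRel_unique
  b_injective h h' := mulRel_unique (mulRel_symm h) (mulRel_symm h')
  b_triangle h h' := by
    have := mulRel_symm (mulRel_mul h h')
    rwa [inv_eq_of_mul_eq_one_right val_b_mul_self_mul_self] at this

lemma step_mulRel_iff {f : V ≃ Fin n} {l : Gen × Bool} {i j : Fin n} :
    Step (mulRel f Gen.a.val) (mulRel f Gen.b.val) l i j ↔ mulRel f (letterVal l) i j := by
  obtain ⟨c, s⟩ := l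
  cases c
  · rw [letterVal_a]; rfl
  · cases s
    · constructor
      · exact fun h => mulRel_symm h
      · intro h
        change mulRel f Gen.b.val j i
        simpa [letterVal] using mulRel_symm h
    · rfl

lemma mulRel_wordVal_of_path {f : V ≃ Fin n} {w : Word} {i j : Fin n}
    (h : Path (mulRel f Gen.a.val) (mulRel f Gen.b.val) w i j) : mulRel f (wordVal w) i j := by
  induction w generalizing i with
  | nil => obtain rfl : i = j := h; simp [mulRel]
  | cons l w ih =>
    obtain ⟨k, h1, h2⟩ := h
    rw [wordVal_cons]
    exact mulRel_mul (step_mulRel_iff.1 h1) (ih h2)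

lemma exists_path_mulRel {f : V ≃ Fin n} {w : Word} {i : Fin n}
    (h : ∀ u v, w = u ++ v → cosetMul H (f.symm i) (wordVal u) ∈ V) :
    ∃ j, Path (mulRel f Gen.a.val) (mulRel f Gen.b.val) w i j := by
  induction w generalizing i with
  | nil => exact ⟨i, rfl⟩
  | cons l w ih =>
    have h1 : cosetMul H (f.symm i) (letterVal l) ∈ V := by simpa using h [l] w rfl
    have hk : mulRel f (letterVal l) i (f ⟨_, h1⟩) := by simp [mulRel]
    obtain ⟨j, hj⟩ := ih (i := f ⟨_, h1⟩) (fun u v huv => by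
      have := h (l :: u) v (by rw [huv]; rfl)
      simpa [cosetMul_mul] using this)
    exact ⟨j, _, step_mulRel_iff.2 hk, hj⟩

end Induced

/-- The vertices of the Stallings graph. -/
abbrev stallingsVerts (H : Subgroup PSL2Z) : Set (Cosets H) := (stallingsGraph H).verts

lemma mem_stallingsVerts_of_prefix {H : Subgroup PSL2Z} {w u v : Word}
    (hw : IsGeodesicLoop H w) (h : w = u ++ v) : coset H (wordVal u) ∈ stallingsVerts H :=
  ⟨Set.mem_univ _, w, hw, u, v, h, rfl⟩

lemma isGeodesicLoop_nil (H : Subgroup PSL2Z) : IsGeodesicLoop H [] :=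
  ⟨fun _ _ => Nat.zero_le _, H.one_mem⟩

lemma coset_one_mem (H : Subgroup PSL2Z) : coset H 1 ∈ stallingsVerts H :=
  mem_stallingsVerts_of_prefix (u := []) (v := []) (isGeodesicLoop_nil H) rfl

/-- A geodesic loop through a vertex other than the root has a letter before it and a letter after
it there. These have different types because the word is reduced, so both types occur. -/
lemma exists_cosetMul_letterVal_mem {H : Subgroup PSL2Z} {x : Cosets H}
    (hx : x ∈ stallingsVerts H) (hx1 : x ≠ coset H 1) (c : Gen) :
    ∃ s, cosetMul H x (letterVal (c, s)) ∈ stallingsVerts H := by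
  obtain ⟨-, w, hw, u, v, rfl, rfl⟩ := hx
  rcases List.eq_nil_or_concat u with rfl | ⟨u, l, rfl⟩
  · exact absurd rfl hx1
  rcases v with _ | ⟨l', v⟩
  · refine absurd (coset_eq_one_iff.2 ?_) hx1
    simpa using hw.2
  have hne : l.1 ≠ l'.1 := by
    have := hw.1.reduced
    rw [Reduced, List.isChain_map, List.isChain_iff_forall_rel_of_append_cons_cons] at this
    exact @this l l' u v (by simp)
  have h1 : ∃ s, cosetMul H (coset H (wordVal (u.concat l))) (letterVal (l.1, s)) ∈
      stallingsVerts H := by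
    refine ⟨!l.2, ?_⟩
    have : letterVal (l.1, !l.2) = (letterVal l)⁻¹ := letterVal_invLetter l
    rw [cosetMul_coset, this]
    have h := mem_stallingsVerts_of_prefix (u := u) (v := l :: l' :: v) hw (by simp)
    simpa using h
  have h2 : ∃ s, cosetMul H (coset H (wordVal (u.concat l))) (letterVal (l'.1, s)) ∈
      stallingsVerts H := by
    refine ⟨l'.2, ?_⟩
    have h := mem_stallingsVerts_of_prefix (u := u.concat l ++ [l']) (v := v) hw (by simp)
    rw [cosetMul_coset]
    simpa [mul_assoc] using h
  obtain ⟨c₁, s₁⟩ := l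
  obtain ⟨c₂, s₂⟩ := l'
  cases c <;> cases c₁ <;> cases c₂ <;> simp only [ne_eq, not_true_eq_false] at hne <;>
    first | exact h1 | exact h2

section Numbered

variable {H H' : Subgroup PSL2Z} {n : ℕ}

lemma exists_path_of_mem_stallingsVerts (f : stallingsVerts H ≃ Fin n)
    (x : stallingsVerts H) : ∃ u : Word, (x : Cosets H) = coset H (wordVal u) ∧
      Path (mulRel f Gen.a.val) (mulRel f Gen.b.val) u (f ⟨_, coset_one_mem H⟩) (f x) := by
  obtain ⟨x, hx⟩ := x
  obtain ⟨-, w, hw, u, v, rfl, rfl⟩ := hx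
  obtain ⟨j, hj⟩ := exists_path_mulRel (f := f) (w := u) (i := f ⟨_, coset_one_mem H⟩)
    (fun u' v' h => by
      have := mem_stallingsVerts_of_prefix (u := u') (v := v' ++ v) hw (by simp [h])
      simpa using this)
  have := mulRel_wordVal_of_path hj
  refine ⟨u, rfl, ?_⟩
  convert hj
  rw [← Equiv.eq_symm_apply]
  apply Subtype.ext
  rw [← this]
  simp

/-- A geodesic word for an element of `H` stays inside the Stallings vertices by their definition.
Hence the numbered graph with its root determines `H`. -/
lemma mem_iff_exists_path (f : stallingsVerts H ≃ Fin n) (g : PSL2Z) :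
    g ∈ H ↔ ∃ w, wordVal w = g ∧ Path (mulRel f Gen.a.val) (mulRel f Gen.b.val) w
      (f ⟨_, coset_one_mem H⟩) (f ⟨_, coset_one_mem H⟩) := by
  constructor
  · intro hg
    obtain ⟨w, hw, rfl⟩ := exists_isGeodesic g
    have hloop : IsGeodesicLoop H w := ⟨hw, hg⟩
    refine ⟨w, rfl, ?_⟩
    obtain ⟨j, hj⟩ := exists_path_mulRel (f := f) (w := w) (i := f ⟨_, coset_one_mem H⟩)
      (fun u' v' h => by
        have := mem_stallingsVerts_of_prefix (u := u') (v := v') hloop h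
        simpa using this)
    have h1 := mulRel_wordVal_of_path hj
    convert hj
    rw [← Equiv.eq_symm_apply]
    apply Subtype.ext
    rw [← h1]
    simpa using (coset_eq_one_iff.2 hg).symm
  · rintro ⟨w, rfl, hw⟩
    have := mulRel_wordVal_of_path hw
    simpa [mulRel, coset_eq_one_iff] using this

lemma eq_of_mulRel_eq (f : stallingsVerts H ≃ Fin n) (f' : stallingsVerts H' ≃ Fin n)
    (h1 : f ⟨_, coset_one_mem H⟩ = f' ⟨_, coset_one_mem H'⟩)
    (ha : mulRel f Gen.a.val = mulRel f' Gen.a.val)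
    (hb : mulRel f Gen.b.val = mulRel f' Gen.b.val) : H = H' := by
  ext g
  rw [mem_iff_exists_path f, mem_iff_exists_path f', h1, ha, hb]

/-- Every vertex is reached from the root by a path, so the rooted graph has no nontrivial
automorphism and its `n!` numberings give distinct labelled graphs. -/
lemma equiv_eq_of_mulRel_eq (f f' : stallingsVerts H ≃ Fin n)
    (h1 : f ⟨_, coset_one_mem H⟩ = f' ⟨_, coset_one_mem H⟩)
    (ha : mulRel f Gen.a.val = mulRel f' Gen.a.val)
    (hb : mulRel f Gen.b.val = mulRel f' Gen.b.val) : f = f' := by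
  ext1 x
  obtain ⟨u, hu, hp⟩ := exists_path_of_mem_stallingsVerts f x
  rw [ha, hb, h1] at hp
  have h2 := mulRel_wordVal_of_path hp
  have h3 : f'.symm (f x) = x := by
    apply Subtype.ext
    rw [← h2, hu]; simp
  rw [← h3, Equiv.apply_symm_apply, h3]

lemma isInvolutive_addLoop_mulRel (f : stallingsVerts H ≃ Fin n) :
    IsInvolutive (addLoop (f ⟨_, coset_one_mem H⟩) (mulRel f Gen.a.val)) := by
  refine (isPartialAction_mulRel f).isInvolutive_addLoop fun x hx => ?_
  obtain ⟨s, hs⟩ := exists_cosetMul_letterVal_mem (f.symm x).2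
    (fun h => hx (by rw [← Equiv.symm_apply_eq]; exact Subtype.ext h)) .a
  rw [letterVal_a] at hs
  exact ⟨f ⟨_, hs⟩, by simp [mulRel]⟩

lemma isTriangular_addLoop_mulRel (f : stallingsVerts H ≃ Fin n) :
    IsTriangular (addLoop (f ⟨_, coset_one_mem H⟩) (mulRel f Gen.b.val)) := by
  refine (isPartialAction_mulRel f).isTriangular_addLoop fun x hx => ?_
  obtain ⟨s, hs⟩ := exists_cosetMul_letterVal_mem (f.symm x).2
    (fun h => hx (by rw [← Equiv.symm_apply_eq]; exact Subtype.ext h)) .b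
  have h : mulRel f (letterVal (.b, s)) x (f ⟨_, hs⟩) := by simp [mulRel]
  refine ⟨f ⟨_, hs⟩, ?_⟩
  cases s
  · right
    have := mulRel_symm h
    simpa [letterVal] using this
  · left; exact h

end Numbered

/-- The involutive relations. -/
abbrev InvolutiveRel (X : Type) : Type := {A : X → X → Prop // IsInvolutive A}

/-- The triangular relations. -/
abbrev TriangularRel (X : Type) : Type := {R : X → X → Prop // IsTriangular R}

lemma exists_numbering {n : ℕ} (H : subgroupsOfSize n) :
    Nonempty (stallingsVerts H.1 ≃ Fin n) := by
  have h := H.2.2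
  have hfin : (stallingsVerts H.1).Finite := Set.finite_of_encard_eq_coe h
  have : Finite (stallingsVerts H.1) := hfin
  refine ⟨Finite.equivFinOfCardEq ?_⟩
  rw [Nat.card_coe_set_eq, Set.ncard, h]; rfl

/-- The completed relations of the numbered Stallings graph, with its root and marks that tell
where a loop was added. -/
noncomputable def numberedGraph (n : ℕ) (p : subgroupsOfSize n × Equiv.Perm (Fin n)) :
    Fin n × InvolutiveRel (Fin n) × TriangularRel (Fin n) × Prop × Prop :=
  let f := (exists_numbering p.1).some.trans p.2
  (f ⟨_, coset_one_mem p.1.1⟩, ⟨_, isInvolutive_addLoop_mulRel f⟩,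
    ⟨_, isTriangular_addLoop_mulRel f⟩,
    IsIsolated (f ⟨_, coset_one_mem p.1.1⟩) (mulRel f Gen.a.val),
    IsIsolated (f ⟨_, coset_one_mem p.1.1⟩) (mulRel f Gen.b.val))

lemma numberedGraph_injective (n : ℕ) : Function.Injective (numberedGraph n) := by
  rintro ⟨H, σ⟩ ⟨H', σ'⟩ h
  simp only [numberedGraph, Prod.mk.injEq, Subtype.mk.injEq] at h
  obtain ⟨h1, h2, h3, h4, h5⟩ := h
  rw [h1] at h2 h3 h4 h5
  have ha := eq_of_addLoop_eq h2 h4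
  have hb := eq_of_addLoop_eq h3 h5
  have hH : H = H' := Subtype.ext (eq_of_mulRel_eq _ _ h1 ha hb)
  subst hH
  have hf := equiv_eq_of_mulRel_eq _ _ h1 ha hb
  congr 1
  ext1 i
  have := congrArg (fun f => f ((exists_numbering H).some.symm i)) hf
  simpa using this

theorem finite_subgroupsOfSize (n : ℕ) : (subgroupsOfSize n).Finite := by
  have : Finite (subgroupsOfSize n) := Finite.of_injective
    (fun H => numberedGraph n (H, 1)) fun H H' h => by
      simpa using numberedGraph_injective n h
  exact this

/-- The factor `n` counts the roots and the factor 4 the two marks. -/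
theorem numSubgroups_mul_factorial_le (n : ℕ) :
    numSubgroups n * n.factorial ≤
      4 * n * (Nat.card (InvolutiveRel (Fin n)) * Nat.card (TriangularRel (Fin n))) := by
  have h := Nat.card_le_card_of_injective _ (numberedGraph_injective n)
  simp only [Nat.card_prod, Nat.card_perm, Nat.card_fin, Nat.card_coe_set_eq] at h
  rw [Nat.card_eq_fintype_card (α := Prop), Fintype.card_prop] at h
  refine h.trans (le_of_eq ?_)
  ring

/-! ### Permutations attached to saturated structures -/

lemma IsInvolutive.exists_perm {X : Type} {A : X → X → Prop} (hA : IsInvolutive A) :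
    ∃ α : Equiv.Perm X, (∀ x, α (α x) = x) ∧ ∀ x y, A x y ↔ α x = y := by
  choose f hf using hA.total
  have hinv : Function.Involutive f := fun x => hA.unique (hf (f x)) (hA.symm (hf x))
  refine ⟨hinv.toPerm, hinv, fun x y => ⟨fun h => hA.unique (hf x) h, ?_⟩⟩
  rintro rfl
  exact hf x

lemma IsTriangular.exists_perm {X : Type} [Finite X] {R : X → X → Prop} (hR : IsTriangular R) :
    ∃ β : Equiv.Perm X, (∀ x y, R x y → β x = y) ∧ ∀ x, R x (β x) ∨ R (β x) x := by
  classical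
  -- Follow the outgoing edge if there is one; otherwise go back along the incoming edge. Single
  -- edges thus become cycles of length two.
  have h : ∀ x, ∃ y, (R x y ∨ R y x) ∧ ∀ z, R x z → z = y := by
    intro x
    by_cases hx : ∃ y, R x y
    · obtain ⟨y, hy⟩ := hx
      exact ⟨y, Or.inl hy, fun z hz => hR.unique hz hy⟩
    · obtain ⟨y, hy⟩ := hR.total x
      exact ⟨y, hy, fun z hz => absurd ⟨z, hz⟩ hx⟩
  choose f hf hf' using h
  have hinj : Function.Injective f := by
    intro x x' hxx
    rcases hf x with h1 | h1 <;> rcases hf x' with h2 | h2 <;> rw [← hxx] at h2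
    · exact hR.injective h1 h2
    · have h3 := hR.triangle h1 h2
      have h4 : f x = x := hxx.trans (hf' _ _ h3).symm
      rw [h4] at h1 h2
      exact hR.unique h1 h2
    · have h3 := hR.triangle h2 h1
      rw [← hf' _ _ h3] at h1 h2
      exact hR.unique h1 h2
    · exact hR.unique h1 h2
  exact ⟨Equiv.ofBijective f (Finite.injective_iff_bijective.1 hinj),
    fun x y h => (hf' x y h).symm, hf⟩

/-! ### Reduced loops in finite saturated structures -/

instance : Finite Gen := Finite.of_injective (fun c : Gen => match c with
  | .a => true
  | .b => false) fun c d h => by cases c <;> cases d <;> simp_all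

/-- The letter that must follow a given letter in a reduced word. -/
def Gen.other (c : Gen) : Gen :=
  match c with
  | .a => .b
  | .b => .a

lemma Gen.eq_other_of_ne {c d : Gen} (h : c ≠ d) : d = c.other := by
  cases c <;> cases d <;> simp_all [Gen.other]

lemma Gen.ne_other (c : Gen) : c ≠ c.other := by cases c <;> simp [Gen.other]

/-- The reduced word `w` leads from the first point to the second; each of the points comes with
the letter that has to be read next. -/
def Walk {X : Type} (A R : X → X → Prop) : Word → X × Gen → X × Gen → Prop
  | [], s, t => s = t
  | l :: w, s, t => l.1 = s.2 ∧ ∃ z, Step A R l s.1 z ∧ Walk A R w (z, s.2.other) t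

section Walk

variable {X : Type} {A R : X → X → Prop}

lemma Walk.append {u v : Word} {s t q : X × Gen} (h : Walk A R u s t) (h' : Walk A R v t q) :
    Walk A R (u ++ v) s q := by
  induction u generalizing s with
  | nil => obtain rfl : s = t := h; exact h'
  | cons l u ih =>
    obtain ⟨h1, z, h2, h3⟩ := h
    exact ⟨h1, z, h2, ih h3⟩

lemma Walk.path {w : Word} {s t : X × Gen} (h : Walk A R w s t) : Path A R w s.1 t.1 := by
  induction w generalizing s with
  | nil => obtain rfl : s = t := h; rfl
  | cons l u ih =>
    obtain ⟨h1, z, h2, h3⟩ := h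
    exact ⟨z, h2, ih h3⟩

lemma Walk.reduced {w : Word} {s t : X × Gen} (h : Walk A R w s t) : Reduced w := by
  induction w generalizing s with
  | nil => exact List.isChain_nil
  | cons l u ih =>
    obtain ⟨h1, z, h2, h3⟩ := h
    have := ih h3
    cases u with
    | nil => simp [Reduced]
    | cons l' u =>
      refine List.isChain_cons_cons.2 ⟨?_, this⟩
      rw [h1, h3.1]
      exact s.2.ne_other

lemma exists_walk {l : Gen × Bool} {w : Word} {x y : X} (hw : Reduced (l :: w))
    (h : Path A R (l :: w) x y) : ∃ c, Walk A R (l :: w) (x, l.1) (y, c) := by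
  induction w generalizing l x with
  | nil =>
    obtain ⟨z, h1, h2⟩ := h
    obtain rfl : z = y := h2
    exact ⟨l.1.other, rfl, z, h1, rfl⟩
  | cons l' w ih =>
    obtain ⟨z, h1, h2⟩ := h
    obtain ⟨c, hc⟩ := ih hw.tail h2
    have hne : l.1 ≠ l'.1 := (List.isChain_cons_cons.1 hw).1
    rw [Gen.eq_other_of_ne hne] at hc
    exact ⟨c, rfl, z, h1, hc⟩

/-- The permutation that follows the letters `a` and `b` in turn. -/
lemma exists_alternating_perm [Finite X] (α β : Equiv.Perm X) :
    ∃ τ : Equiv.Perm (X × Gen), (∀ x, τ (x, .a) = (α x, .b)) ∧ ∀ x, τ (x, .b) = (β x, .a) := by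
  let f : X × Gen → X × Gen := fun s => match s.2 with
    | .a => (α s.1, .b)
    | .b => (β s.1, .a)
  have hf : Function.Injective f := by
    rintro ⟨x, c⟩ ⟨y, d⟩ h
    cases c <;> cases d <;> simp [f] at h <;> simp [h]
  exact ⟨Equiv.ofBijective f (Finite.injective_iff_bijective.1 hf), fun x => rfl, fun x => rfl⟩

/-- A permutation of a finite set has finite order, so iterating `τ` forwards eventually undoes one
application. Retracing the edges would not do, as it breaks reducedness. -/
lemma exists_walk_back_of_perm [Finite X] {τ : Equiv.Perm (X × Gen)}
    (hτ : ∀ s, ∃ w, Walk A R w s (τ s)) (s : X × Gen) : ∃ w, Walk A R w (τ s) s := by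
  have key : ∀ (k : ℕ) (t : X × Gen), ∃ w, Walk A R w t ((τ ^ k) t) := by
    intro k t
    induction k with
    | zero => exact ⟨[], rfl⟩
    | succ k ih =>
      obtain ⟨w, hw⟩ := ih
      obtain ⟨v, hv⟩ := hτ ((τ ^ k) t)
      refine ⟨w ++ v, ?_⟩
      rw [pow_succ']
      exact hw.append hv
  obtain ⟨w, hw⟩ := key (orderOf τ - 1) (τ s)
  refine ⟨w, ?_⟩
  rwa [← Equiv.Perm.mul_apply, ← pow_succ, Nat.sub_add_cancel (orderOf_pos τ), pow_orderOf_eq_one]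
    at hw

lemma exists_walk_back [Finite X] (hA : IsInvolutive A) (hR : IsTriangular R) {w : Word}
    {s t : X × Gen} (h : Walk A R w s t) : ∃ w', Walk A R w' t s := by
  obtain ⟨α, -, hα⟩ := hA.exists_perm
  obtain ⟨β, hβ, hβ'⟩ := hR.exists_perm
  have hstep : ∀ (γ : Equiv.Perm X), (∀ x, R x (γ x) ∨ R (γ x) x) → ∀ τ : Equiv.Perm (X × Gen),
      (∀ x, τ (x, .a) = (α x, .b)) → (∀ x, τ (x, .b) = (γ x, .a)) →
      ∀ s, ∃ w, Walk A R w s (τ s) := by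
    rintro γ hγ τ h1 h2 ⟨x, c⟩
    cases c
    · exact ⟨[(.a, true)], rfl, α x, (hα _ _).2 rfl, (h1 x).symm⟩
    · rcases hγ x with h | h
      · exact ⟨[(.b, true)], rfl, γ x, h, (h2 x).symm⟩
      · exact ⟨[(.b, false)], rfl, γ x, h, (h2 x).symm⟩
  induction w generalizing s with
  | nil => exact ⟨[], h.symm⟩
  | cons l w ih =>
    obtain ⟨x, d⟩ := s
    obtain ⟨c, i⟩ := l
    obtain ⟨h1, z, h2, h3⟩ := h
    obtain rfl : c = d := h1
    obtain ⟨v, hv⟩ := ih h3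
    suffices ∃ u, Walk A R u (z, c.other) (x, c) by
      obtain ⟨u, hu⟩ := this
      exact ⟨v ++ u, hv.append hu⟩
    -- A step along `b` is undone by iterating the alternation of `α` and `β`, a step along its
    -- inverse by that of `α` and `β.symm`.
    obtain ⟨τ, hτ1, hτ2⟩ := exists_alternating_perm α β
    obtain ⟨τ', hτ1', hτ2'⟩ := exists_alternating_perm α β.symm
    have b1 := exists_walk_back_of_perm (hstep β hβ' τ hτ1 hτ2)
    have b2 := exists_walk_back_of_perm (hstep β.symm (fun x => by
      have := hβ' (β.symm x)
      rw [Equiv.apply_symm_apply] at this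
      exact this.symm) τ' hτ1' hτ2')
    cases c
    · have := b1 (x, .a)
      rwa [hτ1, (hα _ _).1 h2] at this
    · cases i
      · have := b2 (x, .b)
        have h2' : R z x := h2
        rwa [hτ2', (Equiv.symm_apply_eq β).2 (hβ _ _ h2').symm] at this
      · have := b1 (x, .b)
        have h2' : R x z := h2
        rwa [hτ2, hβ _ _ h2'] at this

/-- This puts every point reachable from `r` on a geodesic loop, hence among the Stallings vertices.
-/
lemma exists_reduced_loop [Finite X] (hA : IsInvolutive A) (hR : IsTriangular R) {w : Word}
    {r x : X} (h : Path A R w r x) : ∃ u v : Word, Reduced (u ++ v) ∧ Path A R u r x ∧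
      Path A R v x r := by
  obtain ⟨u, h1, -, -, h2⟩ := exists_reduced w
  have hu := h2 X A R (hA.isPartialAction hR) r x h
  cases u with
  | nil => exact ⟨[], [], h1, hu, hu.symm⟩
  | cons l u =>
    obtain ⟨c, hc⟩ := exists_walk h1 hu
    obtain ⟨v, hv⟩ := exists_walk_back hA hR hc
    exact ⟨l :: u, v, (hc.append hv).reduced, hu, hv.path⟩

end Walk

/-! ### The subgroup of a rooted graph -/

/-- The elements represented by the words that label loops at `r`. -/
def loopSubgroup {X : Type} {A R : X → X → Prop} (h : IsPartialAction A R) (r : X) :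
    Subgroup PSL2Z where
  carrier := {g | ∃ w, wordVal w = g ∧ Path A R w r r}
  one_mem' := ⟨[], rfl, rfl⟩
  mul_mem' := by
    rintro _ _ ⟨u, rfl, hu⟩ ⟨v, rfl, hv⟩
    exact ⟨u ++ v, by simp, path_append.2 ⟨r, hu, hv⟩⟩
  inv_mem' := by
    rintro _ ⟨u, rfl, hu⟩
    exact ⟨invWord u, by simp, h.path_invWord hu⟩

section LoopSubgroup

variable {X : Type} {A R : X → X → Prop} {r : X}

/-- The endpoint of a path from `r` depends only on the value of its word, by uniqueness of reduced
forms. So reachable points correspond to the cosets reached. -/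
lemma coset_loopSubgroup_eq_iff (h : IsPartialAction A R) {u v : Word} {x y : X}
    (hu : Path A R u r x) (hv : Path A R v r y) :
    coset (loopSubgroup h r) (wordVal u) = coset (loopSubgroup h r) (wordVal v) ↔ x = y := by
  rw [coset_eq_iff]
  constructor
  · rintro ⟨w, hw, hp⟩
    refine h.path_unique_of_wordVal_eq (w := w ++ u) (w' := v) ?_
      (path_append.2 ⟨r, hp, hu⟩) hv
    simp [hw]
  · rintro rfl
    exact ⟨v ++ invWord u, by simp, path_append.2 ⟨x, hv, h.path_invWord hu⟩⟩

lemma path_of_isGeodesicLoop (h : IsPartialAction A R) {w : Word}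
    (hw : IsGeodesicLoop (loopSubgroup h r) w) : Path A R w r r := by
  obtain ⟨w', hval, hp⟩ := hw.2
  exact h.path_of_reduced hw.1.reduced hval.symm hp

lemma mem_stallingsVerts_loopSubgroup [Finite X] (hA : IsInvolutive A) (hR : IsTriangular R)
    (x : Cosets (loopSubgroup (hA.isPartialAction hR) r)) :
    x ∈ stallingsVerts (loopSubgroup (hA.isPartialAction hR) r) ↔
      ∃ u y, Path A R u r y ∧ x = coset _ (wordVal u) := by
  have h := hA.isPartialAction hR
  constructor
  · rintro ⟨-, w, hw, u, v, rfl, rfl⟩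
    obtain ⟨y, hu, -⟩ := path_append.1 (path_of_isGeodesicLoop h hw)
    exact ⟨u, y, hu, rfl⟩
  · rintro ⟨w, y, hw, rfl⟩
    obtain ⟨u, v, h1, h2, h3⟩ := exists_reduced_loop hA hR hw
    rw [(coset_loopSubgroup_eq_iff h hw h2).2 rfl]
    exact mem_stallingsVerts_of_prefix (v := v)
      ⟨h1.isGeodesic, u ++ v, rfl, path_append.2 ⟨y, h2, h3⟩⟩ rfl

/-- Schreier generators: one for each letter between two points, with a chosen path from `r` to each
point. -/
lemma loopSubgroup_fg [Finite X] (h : IsPartialAction A R)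
    (hc : ∀ x, ∃ w, Path A R w r x) : (loopSubgroup h r).FG := by
  choose u hu using hc
  let E : Set PSL2Z := Set.range (fun p : X × (Gen × Bool) × X =>
    wordVal (u p.1) * letterVal p.2.1 * (wordVal (u p.2.2))⁻¹)
  -- The chosen path from `r` to itself need not be empty, so its value is added in order to undo
  -- the resulting conjugation.
  let T : Set PSL2Z := insert (wordVal (u r)) (E ∩ loopSubgroup h r)
  have hT : T.Finite := ((Set.finite_range _).inter_of_left _).insert _
  refine (Subgroup.fg_iff _).2 ⟨T, le_antisymm ?_ ?_, hT⟩
  · rw [Subgroup.closure_le]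
    rintro g (rfl | hg)
    · exact ⟨u r, rfl, hu r⟩
    · exact hg.2
  · have key : ∀ (w : Word) (x y : X), Path A R w x y →
        wordVal (u x) * wordVal w * (wordVal (u y))⁻¹ ∈ Subgroup.closure T := by
      intro w
      induction w with
      | nil =>
        intro x y hxy
        obtain rfl : x = y := hxy
        simp
      | cons l w ih =>
        rintro x y ⟨z, h1, h2⟩
        have h3 : wordVal (u x) * letterVal l * (wordVal (u z))⁻¹ ∈ Subgroup.closure T := by
          refine Subgroup.subset_closure (Or.inr ⟨⟨(x, l, z), rfl⟩, ?_⟩)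
          refine ⟨u x ++ [l] ++ invWord (u z), by simp [mul_assoc], ?_⟩
          exact path_append.2 ⟨z, path_append.2 ⟨x, hu x, path_singleton.2 h1⟩,
            h.path_invWord (hu z)⟩
        have := Subgroup.mul_mem _ h3 (ih z y h2)
        simpa [mul_assoc] using this
    rintro _ ⟨w, rfl, hw⟩
    have hr : wordVal (u r) ∈ Subgroup.closure T :=
      Subgroup.subset_closure (Or.inl rfl)
    have := Subgroup.mul_mem _ (Subgroup.mul_mem _ (Subgroup.inv_mem _ hr) (key w r r hw)) hr
    simpa [mul_assoc] using this

end LoopSubgroup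

lemma exists_numbered_subgroup {n : ℕ} {A R : Fin n → Fin n → Prop} (hA : IsInvolutive A)
    (hR : IsTriangular R) {r : Fin n} (hc : ∀ x, ∃ w, Path A R w r x) :
    ∃ (H : subgroupsOfSize n) (f : stallingsVerts H.1 ≃ Fin n),
      r = f ⟨_, coset_one_mem H.1⟩ ∧ A = mulRel f Gen.a.val ∧ R = mulRel f Gen.b.val := by
  have h := hA.isPartialAction hR
  choose u hu using hc
  set H := loopSubgroup h r with hH
  let ι : Fin n → stallingsVerts H := fun x => ⟨coset H (wordVal (u x)),
    (mem_stallingsVerts_loopSubgroup hA hR _).2 ⟨u x, x, hu x, rfl⟩⟩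
  have hι : Function.Bijective ι := by
    constructor
    · intro x y hxy
      exact (coset_loopSubgroup_eq_iff h (hu x) (hu y)).1 (congrArg Subtype.val hxy)
    · rintro ⟨x, hx⟩
      obtain ⟨w, y, hw, rfl⟩ := (mem_stallingsVerts_loopSubgroup hA hR _).1 hx
      exact ⟨y, Subtype.ext ((coset_loopSubgroup_eq_iff h (hu y) hw).2 rfl)⟩
  let e := Equiv.ofBijective ι hι
  have hcard : (stallingsVerts H).encard = n := by
    rw [Set.encard, ENat.card_congr e.symm]; simp
  have hstep : ∀ {l x y}, Step A R l x y → mulRel e.symm (letterVal l) x y := by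
    intro l x y hl
    have := (coset_loopSubgroup_eq_iff h (path_append.2 ⟨x, hu x, path_singleton.2 hl⟩)
      (hu y)).2 rfl
    change cosetMul H (coset H (wordVal (u x))) (letterVal l) = coset H (wordVal (u y))
    rw [cosetMul_coset, hH, ← this]
    simp
  refine ⟨⟨H, loopSubgroup_fg h fun x => ⟨u x, hu x⟩, hcard⟩, e.symm, ?_, ?_, ?_⟩
  · rw [Equiv.eq_symm_apply]
    exact Subtype.ext ((coset_loopSubgroup_eq_iff h (v := []) (hu r) rfl).2 rfl)
  · ext x y
    constructor
    · intro hxy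
      exact hstep (l := (.a, true)) hxy
    · intro hxy
      obtain ⟨z, hz⟩ := hA.total x
      rwa [← mulRel_unique (hstep (l := (.a, true)) hz) hxy]
  · have hb : ∀ {x y}, R x y → mulRel e.symm Gen.b.val x y :=
      fun hxy => hstep (l := (.b, true)) hxy
    ext x y
    refine ⟨hb, fun hxy => ?_⟩
    rcases hR.total x with ⟨z, hz | hz⟩
    · rwa [← mulRel_unique (hb hz) hxy]
    -- If `x` has no outgoing edge at hand, an edge in the coset graph from `x` to `y` closes the
    -- triangle on `z`, `x`, `y`, or else injectivity identifies it with an edge of `R`.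
    · rcases hR.total y with ⟨t, ht | ht⟩
      · have h1 := (isPartialAction_mulRel e.symm).b_triangle hxy (hb ht)
        have h2 := (isPartialAction_mulRel e.symm).b_injective h1 (hb hz)
        subst h2
        exact hR.triangle ht hz
      · rwa [← (isPartialAction_mulRel e.symm).b_injective (hb ht) hxy]

/-- The connected saturated structures on `n` points with a root. -/
abbrev RootedGraph (n : ℕ) : Type :=
  {p : Fin n × InvolutiveRel (Fin n) × TriangularRel (Fin n) //
    ∀ x, ∃ w, Path p.2.1.1 p.2.2.1 w p.1 x}

/-- A connected saturated structure is recovered exactly, without marks, from the subgroup and the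
numbering of its Stallings vertices. -/
theorem card_rootedGraph_le (n : ℕ) :
    Nat.card (RootedGraph n) ≤ numSubgroups n * n.factorial := by
  have h : ∀ p : RootedGraph n, ∃ q : subgroupsOfSize n × Equiv.Perm (Fin n),
      let f := (exists_numbering q.1).some.trans q.2
      p.1.1 = f ⟨_, coset_one_mem q.1.1⟩ ∧ p.1.2.1.1 = mulRel f Gen.a.val ∧
        p.1.2.2.1 = mulRel f Gen.b.val := by
    rintro ⟨⟨r, ⟨A, hA⟩, ⟨R, hR⟩⟩, hc⟩
    obtain ⟨H, f, h1, h2, h3⟩ := exists_numbered_subgroup hA hR hc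
    refine ⟨(H, (exists_numbering H).some.symm.trans f), ?_⟩
    have : (exists_numbering H).some.trans ((exists_numbering H).some.symm.trans f) = f := by
      ext x; simp
    simp only [this]
    exact ⟨h1, h2, h3⟩
  choose q hq using h
  have hinj : Function.Injective q := by
    intro p p' hpp
    have h1 := hq p
    have h2 := hq p'
    rw [hpp] at h1
    refine Subtype.ext (Prod.ext (h1.1.trans h2.1.symm) (Prod.ext ?_ ?_))
    · exact Subtype.ext (h1.2.1.trans h2.2.1.symm)
    · exact Subtype.ext (h1.2.2.trans h2.2.2.symm)
  have : Finite (subgroupsOfSize n) := finite_subgroupsOfSize n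
  have h := Nat.card_le_card_of_injective _ hinj
  rw [numSubgroups]
  simpa only [Nat.card_prod, Nat.card_perm, Nat.card_fin, Nat.card_coe_set_eq] using h

/-! ### Disconnected structures -/

/-- The number of pairs of saturated structures on `X`. -/
noncomputable def pairCard (X : Type) : ℕ :=
  Nat.card (InvolutiveRel X) * Nat.card (TriangularRel X)

lemma IsInvolutive.restrict {X : Type} {A : X → X → Prop} (hA : IsInvolutive A) {P : X → Prop}
    (hP : ∀ x y, A x y → (P x ↔ P y)) :
    IsInvolutive (fun x y : {x // P x} => A x y) where
  symm h := hA.symm h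
  unique h h' := Subtype.ext (hA.unique h h')
  total x := by
    obtain ⟨y, hy⟩ := hA.total x
    exact ⟨⟨y, (hP _ _ hy).1 x.2⟩, hy⟩

lemma IsTriangular.restrict {X : Type} {R : X → X → Prop} (hR : IsTriangular R) {P : X → Prop}
    (hP : ∀ x y, R x y → (P x ↔ P y)) :
    IsTriangular (fun x y : {x // P x} => R x y) where
  unique h h' := Subtype.ext (hR.unique h h')
  injective h h' := Subtype.ext (hR.injective h h')
  triangle h h' := hR.triangle h h'
  total x := by
    obtain ⟨y, hy | hy⟩ := hR.total x
    · exact ⟨⟨y, (hP _ _ hy).1 x.2⟩, Or.inl hy⟩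
    · exact ⟨⟨y, (hP _ _ hy).2 x.2⟩, Or.inr hy⟩

/-- The union of relations on a set and on its complement. -/
def glue {X : Type} {P : X → Prop} (A : {x // P x} → {x // P x} → Prop)
    (B : {x // ¬ P x} → {x // ¬ P x} → Prop) (x y : X) : Prop :=
  (∃ hx hy, A ⟨x, hx⟩ ⟨y, hy⟩) ∨ ∃ hx hy, B ⟨x, hx⟩ ⟨y, hy⟩

lemma glue_restrict {X : Type} {A : X → X → Prop} {P : X → Prop}
    (hP : ∀ x y, A x y → (P x ↔ P y)) :
    glue (fun x y : {x // P x} => A x y) (fun x y : {x // ¬ P x} => A x y) = A := by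
  ext x y
  constructor
  · rintro (⟨_, _, h⟩ | ⟨_, _, h⟩) <;> exact h
  · intro h
    by_cases hx : P x
    · exact Or.inl ⟨hx, (hP x y h).1 hx, h⟩
    · exact Or.inr ⟨hx, fun hy => hx ((hP x y h).2 hy), h⟩

/-- The proper nonempty subsets of `Fin n`. -/
abbrev ProperSubset (n : ℕ) : Type := {S : Finset (Fin n) // S.Nonempty ∧ S ≠ Finset.univ}

/-- A root together with saturated structures on a proper nonempty subset and its complement. -/
abbrev SplitGraph (n : ℕ) : Type :=
  Fin n × Σ S : ProperSubset n, (InvolutiveRel {x // x ∈ S.1} × TriangularRel {x // x ∈ S.1}) ×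
    (InvolutiveRel {x // ¬ x ∈ S.1} × TriangularRel {x // ¬ x ∈ S.1})

/-- The subset is the component of the root; no edge leaves it. `SplitGraph` does not require the
root to lie in the subset, and this overcount is harmless. -/
lemma exists_splitGraph {n : ℕ} {A R : Fin n → Fin n → Prop} (hA : IsInvolutive A)
    (hR : IsTriangular R) {r : Fin n} (hc : ¬ ∀ x, ∃ w, Path A R w r x) :
    ∃ q : SplitGraph n, q.1 = r ∧ glue q.2.2.1.1.1 q.2.2.2.1.1 = A ∧
      glue q.2.2.1.2.1 q.2.2.2.2.1 = R := by
  classical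
  have h := hA.isPartialAction hR
  let S : Finset (Fin n) := Finset.univ.filter (fun x => ∃ w, Path A R w r x)
  have hmem : ∀ x, x ∈ S ↔ ∃ w, Path A R w r x := fun x => by simp [S]
  have hstep : ∀ l x y, Step A R l x y → x ∈ S → y ∈ S := by
    intro l x y hl hx
    rw [hmem] at hx ⊢
    obtain ⟨w, hw⟩ := hx
    exact ⟨w ++ [l], path_append.2 ⟨x, hw, path_singleton.2 hl⟩⟩
  have hSA : ∀ x y, A x y → (x ∈ S ↔ y ∈ S) := fun x y hxy =>
    ⟨hstep (.a, true) x y hxy, hstep (.a, true) y x (hA.symm hxy)⟩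
  have hSR : ∀ x y, R x y → (x ∈ S ↔ y ∈ S) := fun x y hxy =>
    ⟨hstep (.b, true) x y hxy, hstep (.b, false) y x hxy⟩
  have hne : S.Nonempty ∧ S ≠ Finset.univ := by
    refine ⟨⟨r, (hmem r).2 ⟨[], rfl⟩⟩, fun hS => hc fun x => ?_⟩
    rw [← hmem, hS]; exact Finset.mem_univ x
  refine ⟨(r, ⟨⟨S, hne⟩, ⟨⟨_, hA.restrict hSA⟩, ⟨_, hR.restrict hSR⟩⟩,
    ⟨_, hA.restrict fun x y hxy => not_congr (hSA x y hxy)⟩,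
    ⟨_, hR.restrict fun x y hxy => not_congr (hSR x y hxy)⟩⟩), rfl, ?_, ?_⟩
  · exact glue_restrict hSA
  · exact glue_restrict hSR

lemma card_splitGraph (n : ℕ) : Nat.card (SplitGraph n) =
    n * ∑ S : ProperSubset n, pairCard {x // x ∈ S.1} * pairCard {x // ¬ x ∈ S.1} := by
  classical
  rw [Nat.card_prod, Nat.card_fin, Nat.card_sigma]
  simp only [Nat.card_prod, pairCard]

lemma card_le_card_rootedGraph_add (n : ℕ) : n * pairCard (Fin n) ≤ Nat.card (RootedGraph n) +
    n * ∑ S : ProperSubset n, pairCard {x // x ∈ S.1} * pairCard {x // ¬ x ∈ S.1} := by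
  classical
  have h : ∀ p : {p : Fin n × InvolutiveRel (Fin n) × TriangularRel (Fin n) //
      ¬ ∀ x, ∃ w, Path p.2.1.1 p.2.2.1 w p.1 x}, ∃ q : SplitGraph n,
      q.1 = p.1.1 ∧ glue q.2.2.1.1.1 q.2.2.2.1.1 = p.1.2.1.1 ∧
      glue q.2.2.1.2.1 q.2.2.2.2.1 = p.1.2.2.1 := by
    rintro ⟨⟨r, ⟨A, hA⟩, ⟨R, hR⟩⟩, hc⟩
    exact exists_splitGraph hA hR hc
  choose q hq using h
  have hinj : Function.Injective q := by
    intro p p' hpp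
    have h1 := hq p
    have h2 := hq p'
    rw [hpp] at h1
    refine Subtype.ext (Prod.ext (h1.1.symm.trans h2.1) (Prod.ext ?_ ?_))
    · exact Subtype.ext (h1.2.1.symm.trans h2.2.1)
    · exact Subtype.ext (h1.2.2.symm.trans h2.2.2)
  have hle := Nat.card_le_card_of_injective _ hinj
  rw [card_splitGraph] at hle
  refine le_trans (le_of_eq ?_) (Nat.add_le_add_left hle _)
  rw [← Nat.card_sum, Nat.card_congr (Equiv.sumCompl _)]
  simp [pairCard]

lemma sum_properSubset (n : ℕ) (f : ℕ → ℝ) :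
    ∑ S : ProperSubset n, f S.1.card = ∑ k ∈ Finset.Ioo 0 n, n.choose k * f k := by
  classical
  have h1 : ∑ S : ProperSubset n, f S.1.card =
      ∑ S ∈ (Finset.univ : Finset (Finset (Fin n))).filter
        (fun S => S.Nonempty ∧ S ≠ Finset.univ), f S.card := by
    rw [Finset.sum_subtype (p := fun S : Finset (Fin n) => S.Nonempty ∧ S ≠ Finset.univ)]
    simp
  have h2 : ∀ S : Finset (Fin n), (S.Nonempty ∧ S ≠ Finset.univ) ↔ S.card ∈ Finset.Ioo 0 n := by
    intro S
    rw [Finset.mem_Ioo, Finset.card_pos]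
    refine and_congr_right fun _ => ?_
    have := Finset.card_lt_iff_ne_univ S
    rw [Fintype.card_fin] at this
    exact this.symm
  rw [h1, Finset.sum_filter]
  simp only [h2]
  have h3 := Finset.sum_powerset_apply_card (fun k => if k ∈ Finset.Ioo 0 n then f k else 0)
    (x := (Finset.univ : Finset (Fin n)))
  rw [Finset.powerset_univ, Finset.card_univ, Fintype.card_fin] at h3
  rw [h3]
  simp only [smul_ite, smul_zero, nsmul_eq_mul]
  rw [← Finset.sum_filter]
  refine Finset.sum_congr ?_ fun _ _ => rfl
  ext k
  simp only [Finset.mem_filter, Finset.mem_range, Finset.mem_Ioo]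
  omega

/-! ### Counting involutive relations -/

-- The size of a conjugacy class is `n!` divided by the order of the centralizer.
open Equiv.Perm in
lemma card_perm_cycleType (X : Type) [Fintype X] [DecidableEq X] (j k : ℕ) :
    (((Finset.univ.filter (fun g : Equiv.Perm X => g.cycleType =
      Multiset.replicate j 2 + Multiset.replicate k 3)).card : ℕ) : ℝ) =
    if 2 * j + 3 * k ≤ Fintype.card X then ((Fintype.card X).factorial : ℝ) /
      ((Fintype.card X - 2 * j - 3 * k).factorial * (j.factorial * 2 ^ j) *
        (k.factorial * 3 ^ k)) else 0 := by
  set m := Multiset.replicate j 2 + Multiset.replicate k 3 with hm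
  have h := card_of_cycleType_mul_eq X m
  have hsum : m.sum = 2 * j + 3 * k := by simp [hm]; ring
  have hprod : m.prod = 2 ^ j * 3 ^ k := by simp [hm]
  have h2 : m.count 2 = j := by simp [hm, Multiset.count_replicate]
  have h3 : m.count 3 = k := by simp [hm, Multiset.count_replicate]
  have hle : ∀ a ∈ m, 2 ≤ a := by
    intro a ha
    simp only [hm, Multiset.mem_add, Multiset.mem_replicate] at ha
    omega
  have hfac : ∏ n ∈ m.toFinset, (m.count n).factorial = j.factorial * k.factorial := by
    rw [Finset.prod_subset (s₂ := {2, 3})]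
    · rw [Finset.prod_pair (by norm_num), h2, h3]
    · intro a ha
      simp only [hm, Multiset.mem_toFinset, Multiset.mem_add, Multiset.mem_replicate] at ha
      simp only [Finset.mem_insert, Finset.mem_singleton]
      omega
    · intro a _ ha
      rw [Multiset.mem_toFinset] at ha
      simp [Multiset.count_eq_zero_of_notMem ha]
  rw [hsum, hprod, hfac] at h
  by_cases h4 : 2 * j + 3 * k ≤ Fintype.card X
  · rw [if_pos ⟨h4, hle⟩] at h
    rw [if_pos h4, eq_div_iff (by positivity), Nat.sub_sub, ← h]
    push_cast
    ring
  · rw [if_neg fun h5 => h4 h5.1] at h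
    rw [if_neg h4]
    have : 0 < (Fintype.card X - (2 * j + 3 * k)).factorial * (2 ^ j * 3 ^ k) *
      (j.factorial * k.factorial) := by positivity
    exact_mod_cast (Nat.mul_eq_zero.1 h).resolve_right this.ne'

lemma card_perm_cycleType_two (X : Type) [Fintype X] [DecidableEq X] (j : ℕ) :
    (((Finset.univ.filter (fun g : Equiv.Perm X => g.cycleType =
      Multiset.replicate j 2)).card : ℕ) : ℝ) =
    if 2 * j ≤ Fintype.card X then ((Fintype.card X).factorial : ℝ) /
      ((Fintype.card X - 2 * j).factorial * (j.factorial * 2 ^ j)) else 0 := by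
  simpa using card_perm_cycleType X j 0

/-- Involutive relations are the graphs of the permutations of exponent two. -/
lemma card_involutiveRel_eq (X : Type) [Fintype X] [DecidableEq X] :
    Nat.card (InvolutiveRel X) =
      (Finset.univ.filter (fun g : Equiv.Perm X => g ^ 2 = 1)).card := by
  let F : {g : Equiv.Perm X // g ^ 2 = 1} → InvolutiveRel X := fun g => ⟨fun x y => g.1 x = y, by
    have hg : ∀ x, g.1 (g.1 x) = x := fun x => by
      have := congrArg (fun h : Equiv.Perm X => h x) g.2
      simpa [sq] using this
    exact ⟨by rintro x y rfl; exact hg x, fun h h' => h.symm.trans h', fun x => ⟨_, rfl⟩⟩⟩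
  have hF : Function.Bijective F := by
    constructor
    · rintro ⟨g, hg⟩ ⟨g', hg'⟩ h
      refine Subtype.ext (Equiv.ext fun x => ?_)
      have h1 : ∀ x y, (g x = y) = (g' x = y) := fun x y =>
        congrFun (congrFun (congrArg Subtype.val h) x) y
      exact ((h1 x (g x)).mp rfl).symm
    · rintro ⟨A, hA⟩
      obtain ⟨α, h1, h2⟩ := hA.exists_perm
      refine ⟨⟨α, Equiv.ext fun x => by simpa [sq] using h1 x⟩, Subtype.ext ?_⟩
      ext x y
      exact (h2 x y).symm
  rw [← Nat.card_congr (Equiv.ofBijective F hF), Nat.card_eq_fintype_card, Fintype.card_subtype]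

theorem card_involutiveRel (X : Type) [Fintype X] :
    (Nat.card (InvolutiveRel X) : ℝ) = (Fintype.card X).factorial * invCoeff (Fintype.card X) := by
  classical
  have hfact : Fact (Nat.Prime 2) := ⟨Nat.prime_two⟩
  have hcount : ∀ g ∈ Finset.univ.filter (fun g : Equiv.Perm X => g ^ 2 = 1),
      g.cycleType.count 2 ∈ Finset.range (Fintype.card X + 1) := by
    intro g _
    have h1 := Multiset.count_le_card 2 g.cycleType
    have h2 : g.cycleType.card * 2 ≤ g.cycleType.sum := by
      rw [← smul_eq_mul]
      exact Multiset.card_nsmul_le_sum fun a ha => Equiv.Perm.two_le_of_mem_cycleType ha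
    have h3 := g.sum_cycleType
    have h4 := Finset.card_le_univ g.support
    rw [Finset.mem_range]
    omega
  rw [card_involutiveRel_eq, Finset.card_eq_sum_card_fiberwise hcount, invCoeff, Finset.mul_sum,
    Finset.sum_filter, Nat.cast_sum]
  refine Finset.sum_congr rfl fun j _ => ?_
  have hset : (Finset.univ.filter (fun g : Equiv.Perm X => g ^ 2 = 1)).filter
      (fun g => g.cycleType.count 2 = j) =
      Finset.univ.filter (fun g : Equiv.Perm X => g.cycleType = Multiset.replicate j 2) := by
    ext g
    simp only [Finset.mem_filter, Finset.mem_univ, true_and,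
      Equiv.Perm.pow_prime_eq_one_iff (p := 2)]
    constructor
    · rintro ⟨h, rfl⟩
      refine Multiset.eq_replicate.2 ⟨?_, h⟩
      exact (Multiset.count_eq_card.2 fun a ha => (h a ha).symm).symm
    · intro h
      rw [h]
      exact ⟨fun c hc => Multiset.eq_of_mem_replicate hc, by simp⟩
  rw [hset, card_perm_cycleType_two]
  split_ifs
  · ring
  · rfl

/-! ### Counting triangular relations -/

section Triangular

variable {X : Type}

/-- The relation with an edge from `x` to `β x`, where the orientation of the edges on the cycles
of length two is given by the set `O`. -/
def orientedRel [LinearOrder X] (β : Equiv.Perm X) (O : Finset X) (x y : X) : Prop :=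
  y = β x ∧ (β y = x → x ≠ y → (x < y ∧ x ∈ O) ∨ (y < x ∧ y ∉ O))

/-- The smaller points of the cycles of length two. -/
def swapMins [Fintype X] [LinearOrder X] (β : Equiv.Perm X) : Finset X :=
  Finset.univ.filter (fun x => β (β x) = x ∧ x < β x)

/-- All cycles of the permutation have length at most three. -/
def IsShort (β : Equiv.Perm X) : Prop := ∀ x, β (β x) = x ∨ β (β (β x)) = x

lemma orientedRel_or [LinearOrder X] (β : Equiv.Perm X) (O : Finset X) (x : X) :
    orientedRel β O x (β x) ∨ orientedRel β O (β x) x := by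
  by_cases h1 : β (β x) = x
  · rcases lt_trichotomy x (β x) with h2 | h2 | h2
    · by_cases h3 : x ∈ O
      · exact Or.inl ⟨rfl, fun _ _ => Or.inl ⟨h2, h3⟩⟩
      · exact Or.inr ⟨h1.symm, fun _ _ => Or.inr ⟨h2, h3⟩⟩
    · exact Or.inl ⟨rfl, fun _ h => absurd h2 h⟩
    · by_cases h3 : β x ∈ O
      · exact Or.inr ⟨h1.symm, fun _ _ => Or.inl ⟨h2, h3⟩⟩
      · exact Or.inl ⟨rfl, fun _ _ => Or.inr ⟨h2, h3⟩⟩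
  · exact Or.inl ⟨rfl, fun h => absurd h h1⟩

lemma IsShort.isTriangular_orientedRel [LinearOrder X] {β : Equiv.Perm X} (hβ : IsShort β)
    (O : Finset X) : IsTriangular (orientedRel β O) where
  unique h h' := h.1.trans h'.1.symm
  injective h h' := β.injective (h.1.symm.trans h'.1)
  triangle := by
    rintro x y z ⟨rfl, h1⟩ ⟨rfl, h2⟩
    by_cases hx : β x = x
    · simp only [hx] at h1 h2 ⊢
      exact ⟨hx.symm, fun _ h => absurd rfl h⟩
    by_cases h3 : β (β x) = x
    -- A cycle of length two carries only one of its two possible edges, so no path of two edges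
    -- runs along it.
    · exfalso
      have h4 := h1 h3 (Ne.symm hx)
      have h5 := h2 (by rw [h3]) (by rw [h3]; exact hx)
      rw [h3] at h5
      rcases h4 with ⟨h4, h6⟩ | ⟨h4, h6⟩ <;> rcases h5 with ⟨h5, h7⟩ | ⟨h5, h7⟩
      · exact lt_asymm h4 h5
      · exact h7 h6
      · exact h6 h7
      · exact lt_asymm h4 h5
    · have h4 := (hβ x).resolve_left h3
      refine ⟨h4.symm, fun h5 => ?_⟩
      exact absurd (β.injective h5).symm hx
  total x := by
    rcases orientedRel_or β O x with h | h
    · exact ⟨_, Or.inl h⟩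
    · exact ⟨_, Or.inr h⟩

lemma IsTriangular.perm_unique {R : X → X → Prop} (hR : IsTriangular R) {β β' : Equiv.Perm X}
    (h1 : ∀ x y, R x y → β x = y) (h2 : ∀ x, R x (β x) ∨ R (β x) x)
    (h1' : ∀ x y, R x y → β' x = y) (h2' : ∀ x, R x (β' x) ∨ R (β' x) x) : β = β' := by
  ext x
  rcases h2 x with h | h
  · exact (h1' _ _ h).symm
  · rcases h2' x with h' | h'
    · exact h1 _ _ h'
    · exact hR.injective h h'

lemma IsTriangular.isShort {R : X → X → Prop} (hR : IsTriangular R) {β : Equiv.Perm X}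
    (h1 : ∀ x y, R x y → β x = y) (h2 : ∀ x, R x (β x) ∨ R (β x) x) : IsShort β := by
  intro x
  rcases h2 x with h | h
  · rcases h2 (β x) with h' | h'
    · exact Or.inr (h1 _ _ (hR.triangle h h'))
    · exact Or.inl (hR.injective h' h)
  · exact Or.inl (h1 _ _ h)

lemma IsTriangular.orientedRel_eq [Fintype X] [LinearOrder X] {R : X → X → Prop}
    (hR : IsTriangular R) {β : Equiv.Perm X} (h1 : ∀ x y, R x y → β x = y)
    (h2 : ∀ x, R x (β x) ∨ R (β x) x) {O : Finset X}
    (hO : ∀ x, x ∈ O ↔ x ∈ swapMins β ∧ R x (β x)) : orientedRel β O = R := by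
  have hloop : ∀ x y, R x y → R y x → x = y := fun x y h h' =>
    hR.unique (hR.triangle h h') h
  ext x y
  constructor
  · rintro ⟨rfl, h⟩
    rcases h2 x with h3 | h3
    · exact h3
    · have h4 := h1 _ _ h3
      by_cases hx : x = β x
      · rw [← hx] at h3 ⊢; exact h3
      · rcases h h4 hx with ⟨h5, h6⟩ | ⟨h5, h6⟩
        · exact ((hO x).1 h6).2
        · refine absurd ((hO (β x)).2 ⟨?_, ?_⟩) h6
          · simp only [swapMins, Finset.mem_filter, Finset.mem_univ, true_and]
            rw [h4]; exact ⟨rfl, h5⟩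
          · rw [h4]; exact h3
  · intro h
    have hy := h1 _ _ h
    refine ⟨hy.symm, fun h3 h4 => ?_⟩
    rcases lt_or_gt_of_ne h4 with h5 | h5
    · left
      refine ⟨h5, (hO x).2 ⟨?_, by rwa [hy]⟩⟩
      simp only [swapMins, Finset.mem_filter, Finset.mem_univ, true_and]
      rw [hy]; exact ⟨h3, h5⟩
    · right
      refine ⟨h5, fun h6 => h4 ?_⟩
      have := ((hO y).1 h6).2
      rw [h3] at this
      exact hloop x y h this

end Triangular

/-- A triangular relation is a permutation with cycles of length at most three and an independent
orientation for each cycle of length two, encoded by a subset of the smaller points of these cycles.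
-/
lemma card_triangularRel_eq (X : Type) [Fintype X] [LinearOrder X]
    [DecidablePred (IsShort (X := X))] :
    Nat.card (TriangularRel X) =
      ∑ β ∈ Finset.univ.filter (fun β : Equiv.Perm X => IsShort β), 2 ^ (swapMins β).card := by
  classical
  let F : (Σ β : {β : Equiv.Perm X // IsShort β}, {O : Finset X // O ∈ (swapMins β.1).powerset}) →
      TriangularRel X := fun p => ⟨orientedRel p.1.1 p.2.1, p.1.2.isTriangular_orientedRel _⟩
  have hF : Function.Bijective F := by
    constructor
    · rintro ⟨⟨β, hβ⟩, ⟨O, hO⟩⟩ ⟨⟨β', hβ'⟩, ⟨O', hO'⟩⟩ h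
      have h0 : orientedRel β O = orientedRel β' O' := congrArg Subtype.val h
      have hββ : β = β' := by
        refine (hβ.isTriangular_orientedRel O).perm_unique (fun x y h => h.1.symm)
          (orientedRel_or β O) ?_ ?_
        · intro x y h; rw [h0] at h; exact h.1.symm
        · rw [h0]; exact orientedRel_or β' O'
      subst hββ
      have hmem : ∀ {O O' : Finset X}, O ∈ (swapMins β).powerset →
          orientedRel β O = orientedRel β O' → ∀ x ∈ O, x ∈ O' := by
        intro O O' hO h0 x hx
        have hx' := Finset.mem_powerset.1 hO hx
        simp only [swapMins, Finset.mem_filter, Finset.mem_univ, true_and] at hx'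
        have h1 : orientedRel β O x (β x) := ⟨rfl, fun _ _ => Or.inl ⟨hx'.2, hx⟩⟩
        rw [h0] at h1
        rcases h1.2 hx'.1 hx'.2.ne with h2 | h2
        · exact h2.2
        · exact absurd h2.1 hx'.2.asymm
      have : O = O' := Finset.ext fun x => ⟨hmem hO h0 x, hmem hO' h0.symm x⟩
      subst this
      rfl
    · rintro ⟨R, hR⟩
      obtain ⟨β, h1, h2⟩ := hR.exists_perm
      refine ⟨⟨⟨β, hR.isShort h1 h2⟩, ⟨(swapMins β).filter (fun x => R x (β x)),
        Finset.mem_powerset.2 (Finset.filter_subset _ _)⟩⟩, Subtype.ext ?_⟩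
      exact hR.orientedRel_eq h1 h2 fun x => Finset.mem_filter
  rw [← Nat.card_congr (Equiv.ofBijective F hF), Nat.card_sigma,
    ← Finset.sum_subtype_of_mem (p := IsShort) (fun β => 2 ^ (swapMins β).card)
      (s := Finset.univ.filter (fun β : Equiv.Perm X => IsShort β))
      (fun β hβ => (Finset.mem_filter.1 hβ).2)]
  refine Finset.sum_congr ?_ fun β _ => ?_
  · ext β
    simpa using β.2
  · rw [Nat.card_eq_fintype_card, Fintype.card_coe, Finset.card_powerset]

section CycleType

open Equiv.Perm

variable {X : Type} [Fintype X] [DecidableEq X]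

lemma pow_apply_eq_self_iff {β : Equiv.Perm X} {x : X} (hx : β x ≠ x) (k : ℕ) :
    (β ^ k) x = x ↔ (cycleOf β x).support.card ∣ k := by
  have hc := isCycle_cycleOf β hx
  rw [← hc.orderOf, orderOf_dvd_iff_pow_eq_one,
    hc.pow_eq_one_iff' (x := x) (by rwa [cycleOf_apply_self]), cycleOf_pow_apply_self]

lemma mem_cycleType_iff_exists_cycleOf {β : Equiv.Perm X} {c : ℕ} :
    c ∈ β.cycleType ↔ ∃ x, β x ≠ x ∧ (cycleOf β x).support.card = c := by
  rw [cycleType_def, Multiset.mem_map]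
  constructor
  · rintro ⟨g, hg, rfl⟩
    have hg' : g ∈ β.cycleFactorsFinset := hg
    obtain ⟨x, hx⟩ := (mem_cycleFactorsFinset_iff.1 hg').1.nonempty_support
    have h1 := cycle_is_cycleOf hx hg'
    refine ⟨x, ?_, by rw [← h1]; rfl⟩
    exact mem_support.1 (mem_cycleFactorsFinset_support_le hg' hx)
  · rintro ⟨x, hx, rfl⟩
    exact ⟨cycleOf β x, cycleOf_mem_cycleFactorsFinset_iff.2 (mem_support.2 hx), rfl⟩

lemma isShort_iff_cycleType {β : Equiv.Perm X} :
    IsShort β ↔ ∀ c ∈ β.cycleType, c = 2 ∨ c = 3 := by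
  have h2 : ∀ x, (β ^ 2) x = β (β x) := fun x => rfl
  have h3 : ∀ x, (β ^ 3) x = β (β (β x)) := fun x => rfl
  constructor
  · intro h c hc
    have hc2 := two_le_of_mem_cycleType hc
    obtain ⟨x, hx, rfl⟩ := mem_cycleType_iff_exists_cycleOf.1 hc
    rcases h x with h | h
    · rw [← h2, pow_apply_eq_self_iff hx] at h
      have := Nat.le_of_dvd (by norm_num) h
      left; omega
    · rw [← h3, pow_apply_eq_self_iff hx] at h
      have := (Nat.dvd_prime Nat.prime_three).1 h
      right; omega
  · intro h x
    by_cases hx : β x = x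
    · left; rw [hx, hx]
    · rcases h _ (mem_cycleType_iff_exists_cycleOf.2 ⟨x, hx, rfl⟩) with h4 | h4
      · left; rw [← h2, pow_apply_eq_self_iff hx, h4]
      · right; rw [← h3, pow_apply_eq_self_iff hx, h4]

end CycleType

open Equiv.Perm in
lemma card_swapMins {X : Type} [Fintype X] [LinearOrder X] (β : Equiv.Perm X) :
    (swapMins β).card = β.cycleType.count 2 := by
  have hcount : β.cycleType.count 2 =
      (β.cycleFactorsFinset.filter (fun c => 2 = c.support.card)).card := by
    rw [cycleType_def, Multiset.count_map]; rfl
  have h2 : ∀ x, (β ^ 2) x = β (β x) := fun x => rfl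
  rw [hcount]
  refine Finset.card_bij (fun x _ => cycleOf β x) ?_ ?_ ?_
  · intro x hx
    simp only [swapMins, Finset.mem_filter, Finset.mem_univ, true_and] at hx
    have hne : β x ≠ x := hx.2.ne'
    refine Finset.mem_filter.2 ⟨cycleOf_mem_cycleFactorsFinset_iff.2 (mem_support.2 hne), ?_⟩
    have h3 := (pow_apply_eq_self_iff hne 2).1 hx.1
    have h4 := (isCycle_cycleOf β hne).two_le_card_support
    have := Nat.le_of_dvd (by norm_num) h3
    omega
  · intro x hx y hy hxy
    simp only [swapMins, Finset.mem_filter, Finset.mem_univ, true_and] at hx hy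
    have hy' : y ∈ (cycleOf β x).support := by
      rw [hxy, mem_support, cycleOf_apply_self]; exact hy.2.ne'
    obtain ⟨i, hi⟩ := (mem_support_cycleOf_iff.1 hy').1.exists_nat_pow_eq
    have hpow : ∀ i : ℕ, (β ^ i) x = x ∨ (β ^ i) x = β x := by
      intro i
      induction i with
      | zero => exact Or.inl rfl
      | succ i ih =>
        rw [pow_succ', mul_apply]
        rcases ih with h | h <;> rw [h]
        · exact Or.inr rfl
        · exact Or.inl hx.1
    rcases hpow i with h | h
    · exact h.symm.trans hi
    · rw [hi] at h
      subst h
      rw [hx.1] at hy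
      exact absurd hx.2 hy.2.asymm
  · intro c hc
    obtain ⟨hc, hcard⟩ := Finset.mem_filter.1 hc
    obtain ⟨x, y, hxy, rfl⟩ := card_support_eq_two.1 hcard.symm
    have hβ := (mem_cycleFactorsFinset_iff.1 hc).2
    have hx : β x = y := by
      rw [← hβ x (by rw [support_swap hxy]; simp), Equiv.swap_apply_left]
    have hy : β y = x := by
      rw [← hβ y (by rw [support_swap hxy]; simp), Equiv.swap_apply_right]
    rcases lt_or_gt_of_ne hxy with h | h
    · refine ⟨x, ?_, (cycle_is_cycleOf (by rw [support_swap hxy]; simp) hc).symm⟩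
      simp only [swapMins, Finset.mem_filter, Finset.mem_univ, true_and, hx, hy]
      exact h
    · refine ⟨y, ?_, (cycle_is_cycleOf (by rw [support_swap hxy]; simp) hc).symm⟩
      simp only [swapMins, Finset.mem_filter, Finset.mem_univ, true_and, hx, hy]
      exact h

/-- The `2 ^ j` orientations cancel the `2 ^ j` of the centralizer; this is why the generating
function has `z ^ 2` and not `z ^ 2 / 2`. -/
theorem card_triangularRel (X : Type) [Fintype X] [LinearOrder X] :
    (Nat.card (TriangularRel X) : ℝ) =
      (Fintype.card X).factorial * triCoeff (Fintype.card X) := by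
  classical
  have hcount : ∀ β ∈ Finset.univ.filter (fun β : Equiv.Perm X => IsShort β),
      (β.cycleType.count 2, β.cycleType.count 3) ∈
        Finset.range (Fintype.card X + 1) ×ˢ Finset.range (Fintype.card X + 1) := by
    intro g _
    have h1 := Multiset.count_le_card 2 g.cycleType
    have h1' := Multiset.count_le_card 3 g.cycleType
    have h2 : g.cycleType.card * 2 ≤ g.cycleType.sum := by
      rw [← smul_eq_mul]
      exact Multiset.card_nsmul_le_sum fun a ha => Equiv.Perm.two_le_of_mem_cycleType ha
    have h3 := g.sum_cycleType
    have h4 := Finset.card_le_univ g.support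
    rw [Finset.mem_product, Finset.mem_range, Finset.mem_range]
    constructor <;> dsimp only <;> omega
  rw [card_triangularRel_eq, ← Finset.sum_fiberwise_of_maps_to hcount, triCoeff, Finset.mul_sum,
    Finset.sum_filter, Nat.cast_sum]
  refine Finset.sum_congr rfl fun p _ => ?_
  obtain ⟨j, k⟩ := p
  have hset : (Finset.univ.filter (fun β : Equiv.Perm X => IsShort β)).filter
      (fun β => (β.cycleType.count 2, β.cycleType.count 3) = (j, k)) =
      Finset.univ.filter (fun g : Equiv.Perm X => g.cycleType =
        Multiset.replicate j 2 + Multiset.replicate k 3) := by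
    ext g
    simp only [Finset.mem_filter, Finset.mem_univ, true_and, isShort_iff_cycleType,
      Prod.mk.injEq]
    constructor
    · rintro ⟨h, rfl, rfl⟩
      ext c
      rw [Multiset.count_add, Multiset.count_replicate, Multiset.count_replicate]
      by_cases h2 : 2 = c
      · subst h2; simp
      · by_cases h3 : 3 = c
        · subst h3; simp
        · rw [if_neg h2, if_neg h3, Multiset.count_eq_zero]
          intro hc
          have := h c hc
          omega
    · intro h
      rw [h]
      refine ⟨fun c hc => ?_, ?_, ?_⟩
      · rw [Multiset.mem_add, Multiset.mem_replicate, Multiset.mem_replicate] at hc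
        omega
      · simp [Multiset.count_replicate]
      · simp [Multiset.count_replicate]
  rw [hset]
  have hsum : ∑ β ∈ Finset.univ.filter (fun g : Equiv.Perm X => g.cycleType =
      Multiset.replicate j 2 + Multiset.replicate k 3), 2 ^ (swapMins β).card =
      (Finset.univ.filter (fun g : Equiv.Perm X => g.cycleType =
        Multiset.replicate j 2 + Multiset.replicate k 3)).card * 2 ^ j := by
    rw [Finset.sum_congr rfl (g := fun _ => 2 ^ j), Finset.sum_const, smul_eq_mul]
    intro β hβ
    rw [card_swapMins, (Finset.mem_filter.1 hβ).2]
    simp [Multiset.count_replicate]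
  rw [hsum, Nat.cast_mul, card_perm_cycleType]
  split_ifs
  · push_cast; field_simp
  · simp

/-! ### Assembly of the two-sided estimate. -/

lemma pairCard_eq (X : Type) [Fintype X] [LinearOrder X] :
    (pairCard X : ℝ) = (Fintype.card X).factorial * pairCount (Fintype.card X) := by
  rw [pairCard, Nat.cast_mul, card_involutiveRel, card_triangularRel, pairCount]
  ring

/-- The binomial coefficient counting subsets of size `k` cancels `k! * (n - k)!` against `n!`,
leaving a plain convolution. -/
lemma sum_pairCard_mul (n : ℕ) :
    ((∑ S : ProperSubset n, pairCard {x // x ∈ S.1} * pairCard {x // ¬ x ∈ S.1} : ℕ) : ℝ) =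
      n.factorial * ∑ k ∈ Finset.Ioo 0 n, pairCount k * pairCount (n - k) := by
  have h : ∀ S : ProperSubset n,
      ((pairCard {x // x ∈ S.1} * pairCard {x // ¬ x ∈ S.1} : ℕ) : ℝ) =
      (fun k : ℕ => (k.factorial * pairCount k) * ((n - k).factorial * pairCount (n - k)))
        S.1.card := by
    intro S
    rw [Nat.cast_mul, pairCard_eq, pairCard_eq, Fintype.card_coe, Fintype.card_subtype_compl,
      Fintype.card_fin, Fintype.card_coe]
  rw [Nat.cast_sum, Finset.sum_congr rfl fun S _ => h S]
  have key := sum_properSubset n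
    fun k : ℕ => (k.factorial * pairCount k) * ((n - k).factorial * pairCount (n - k))
  refine key.trans ?_
  rw [Finset.mul_sum]
  refine Finset.sum_congr rfl fun k hk => ?_
  have hk' := (Finset.mem_Ioo.1 hk).2.le
  rw [← Nat.choose_mul_factorial_mul_factorial hk']
  push_cast
  ring

lemma numSubgroups_le (n : ℕ) : (numSubgroups n : ℝ) ≤ 4 * (n * pairCount n) := by
  have h : ((numSubgroups n * n.factorial : ℕ) : ℝ) ≤
      ((4 * n * pairCard (Fin n) : ℕ) : ℝ) := by
    exact_mod_cast numSubgroups_mul_factorial_le n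
  push_cast at h
  rw [pairCard_eq, Fintype.card_fin] at h
  have hf : (0 : ℝ) < n.factorial := by positivity
  refine le_of_mul_le_mul_right ?_ hf
  linarith

/-- For large `n`, at most half of the rooted pairs are disconnected, and the connected ones inject
into numbered subgroups. -/
lemma le_numSubgroups : ∀ᶠ n : ℕ in Filter.atTop,
    (n * pairCount n) / 2 ≤ (numSubgroups n : ℝ) := by
  filter_upwards [eventually_sum_pairCount_mul_le] with n hn
  have h1 := card_rootedGraph_le n
  have h2 := card_le_card_rootedGraph_add n
  have h : ((n * pairCard (Fin n) : ℕ) : ℝ) ≤ ((numSubgroups n * n.factorial +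
      n * ∑ S : ProperSubset n, pairCard {x // x ∈ S.1} * pairCard {x // ¬ x ∈ S.1} : ℕ) : ℝ) := by
    exact_mod_cast h2.trans (Nat.add_le_add_right h1 _)
  rw [Nat.cast_add, Nat.cast_mul, Nat.cast_mul, Nat.cast_mul, sum_pairCard_mul, pairCard_eq,
    Fintype.card_fin] at h
  have hf : (0 : ℝ) < n.factorial := by positivity
  refine le_of_mul_le_mul_right ?_ hf
  have h3 : (n : ℝ) * (n.factorial * ∑ k ∈ Finset.Ioo 0 n, pairCount k * pairCount (n - k)) ≤
      n * (n.factorial * (pairCount n / 2)) := by gcongr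
  linarith

lemma numSubgroups_isTheta :
    (fun n : ℕ => (numSubgroups n : ℝ)) =Θ[Filter.atTop] (fun n : ℕ => (n : ℝ) * pairCount n) := by
  have hp : ∀ n : ℕ, 0 ≤ (n : ℝ) * pairCount n := fun n =>
    mul_nonneg n.cast_nonneg (pairCount_pos n).le
  constructor
  · refine Asymptotics.IsBigO.of_bound 4 (Filter.Eventually.of_forall fun n => ?_)
    rw [Real.norm_of_nonneg (hp n), Real.norm_of_nonneg (Nat.cast_nonneg _)]
    exact numSubgroups_le n
  · refine Asymptotics.IsBigO.of_bound 2 ?_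
    filter_upwards [le_numSubgroups] with n hn
    rw [Real.norm_of_nonneg (hp n), Real.norm_of_nonneg (Nat.cast_nonneg _)]
    linarith

end PSL2Z

theorem mainTheorem1 :
    (∀ n : ℕ, (PSL2Z.subgroupsOfSize n).Finite) ∧
    Asymptotics.IsTheta Filter.atTop
      (fun n : ℕ => (PSL2Z.numSubgroups n : ℝ))
      (fun n : ℕ => (n : ℝ) ^ ((n : ℝ) / 6 + 1 / 2) *
        Real.exp (-((n : ℝ) / 6) + (n : ℝ) ^ ((2 : ℝ) / 3) + (n : ℝ) ^ ((1 : ℝ) / 2)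
          + 1 / 3 * (n : ℝ) ^ ((1 : ℝ) / 3))) := by
  refine ⟨PSL2Z.finite_subgroupsOfSize, PSL2Z.numSubgroups_isTheta.trans ?_⟩
  refine ((Asymptotics.isTheta_refl (fun n : ℕ => (n : ℝ)) Filter.atTop).mul
    PSL2Z.pairCount_isTheta).trans_eventuallyEq ?_
  filter_upwards [Filter.eventually_ge_atTop 1] with n hn
  exact PSL2Z.mul_pairGrowth_eq hn
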